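/- Let $\mathcal K^2$ be the space of planar convex bodies (nonempty compact convex subsets of the Euclidean plane $\mathbb R^2$) with the Hausdorff metric. For $K\in\mathcal K^2$ and a unit vector $u$ let $F(K,u)=\{x\in K:\langle x,u\rangle=\max_{y\in K}\langle y,u\rangle\}$, and let the middle hedgehog of $K$ be $\mathcal M_K=\bigcup_{|u|=1}\tfrac12\,[F(K,u)+F(K,-u)]$ (the set of all midpoints of affine diameters of $K$, when $K$ has interior points). Then for a typical $K\in\mathcal K^2$ the convex hull $\operatorname{conv}\mathcal M_K$ has infinitely many exposed points; that is, the set of all $K\in\mathcal K^2$ with this property is comeager in $\mathcal K^2$ (its complement is a countable union of nowhere dense sets). Moreover, let $\mathcal K^2_*\subset\mathcal K^2$ be the subspace of strictly convex bodies (those whose boundary contains no nondegenerate segment). For every $k\in\mathbb N$ the set $\mathcal A_k=\{K\in\mathcal K^2_*:\operatorname{conv}\mathcal M_K\text{ has at most }k\text{ exposed points}\}$ is closed and nowhere dense in $\mathcal K^2_*$, and $\mathcal K^2_*$ is a dense $G_\delta$ set in $\mathcal K^2$. -/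

import Mathlib

open scoped Pointwise

/-- The Euclidean plane. -/
abbrev Plane : Type := EuclideanSpace ℝ (Fin 2)

/-- The support function of a convex body. -/
noncomputable def supportFun (K : ConvexBody Plane) (u : Plane) : ℝ :=
  sSup ((fun x : Plane => inner ℝ x u) '' (K : Set Plane))

/-- The supporting line `H(K,u)` of `K` with outer normal vector `u`. -/
def supportLine (K : ConvexBody Plane) (u : Plane) : Set Plane :=
  {x | inner ℝ x u = supportFun K u}

/-- The face `F(K,u) = K ∩ H(K,u)` of `K` with outer normal vector `u`. -/
def supportFace (K : ConvexBody Plane) (u : Plane) : Set Plane :=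
  (K : Set Plane) ∩ supportLine K u

/-- The middle set `Z_K(u) = (1/2)[F(K,u) + F(K,-u)]` of `K` with normal vector `u`. -/
noncomputable def middleSet (K : ConvexBody Plane) (u : Plane) : Set Plane :=
  (1 / 2 : ℝ) • (supportFace K u + supportFace K (-u))

/-- The middle hedgehog of `K`: the union of the middle sets over all unit vectors. -/
noncomputable def middleHedgehog (K : ConvexBody Plane) : Set Plane :=
  ⋃ u ∈ Metric.sphere (0 : Plane) 1, middleSet K u

/-- The exposed points of the convex hull of the middle hedgehog of `K`. -/
noncomputable def hedgehogExposedPoints (K : ConvexBody Plane) : Set Plane :=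
  Set.exposedPoints ℝ (convexHull ℝ (middleHedgehog K))

/-- The space of strictly convex planar convex bodies, a subspace of the space of all
planar convex bodies. -/
abbrev StrictlyConvexBody : Type :=
  {K : ConvexBody Plane // StrictConvex ℝ (K : Set Plane)}

/-! Everything reduces to two facts: having many exposed points is stable under perturbation, and it
can be created by an arbitrarily small perturbation.

Stability. Faces have a closed graph in `(K, u, x)`, so `middleHedgehog` is compact and upper
semicontinuous in `K`; near a normal whose middle set is a single point it is also lower
semicontinuous. An exposed point of the hull of a compact set survives nearby when the set is
perturbed in both senses (`exists_forall_le_encard_exposedPoints`). In a strictly convex body every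
middle set is a single point, so having more than `k` exposed points is an open condition there, and
`A_k` is closed.

Creation. Middle sets are Minkowski additive for each fixed normal. Approximate `K` by a polygon `P`
without parallel edges; its hedgehog hull has a vertex `p` that is the whole middle set for an open
cone of normals. Add small thin triangles. The triangle attached to a vector `z` has middle set
`{0}` except for normals almost orthogonal to `z`, where the value `{z}` occurs; triangles attached
to pairwise nonparallel vectors are therefore never active together. Taking the vectors `z i` on a
short parabolic arc, with active normals inside the cone of `p`, splits `p` into the `n` exposed
points `p + z i` (`exists_dist_lt_exposed`). By stability a nearby strictly convex body still has at
least `n` exposed points, so `A_k` has empty interior.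

Strictly convex bodies form a dense Gδ set, and a set nowhere dense in a subspace is nowhere dense
in the whole space. Outside countably many meagre sets the number of exposed points is thus
infinite. -/

section SupportFaces

/-! ### Faces, middle sets and their semicontinuity; strict convexity as a Gδ condition. -/

open Set Metric Filter Topology

theorem supportFun_eq_of_forall_le {K : ConvexBody Plane} {x u : Plane} (hx : x ∈ K)
    (h : ∀ y ∈ K, inner ℝ y u ≤ inner ℝ x u) : supportFun K u = inner ℝ x u :=
  IsGreatest.csSup_eq ⟨⟨x, hx, rfl⟩, by rintro _ ⟨y, hy, rfl⟩; exact h y hy⟩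

theorem exists_forall_inner_le (K : ConvexBody Plane) (u : Plane) :
    ∃ x ∈ K, ∀ y ∈ K, inner ℝ y u ≤ inner ℝ x u := by
  obtain ⟨x, hx, h⟩ := K.isCompact.exists_isMaxOn K.nonempty
    (f := fun x : Plane => inner ℝ x u) (by fun_prop)
  exact ⟨x, hx, fun y hy => h hy⟩

theorem mem_supportFace {K : ConvexBody Plane} {x u : Plane} :
    x ∈ supportFace K u ↔ x ∈ K ∧ ∀ y ∈ K, inner ℝ y u ≤ inner ℝ x u := by
  constructor
  · rintro ⟨hx, h⟩
    obtain ⟨z, hz, hmax⟩ := exists_forall_inner_le K u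
    have h' : inner ℝ x u = supportFun K u := h
    rw [supportFun_eq_of_forall_le hz hmax] at h'
    exact ⟨hx, fun y hy => h' ▸ hmax y hy⟩
  · rintro ⟨hx, h⟩
    exact ⟨hx, (supportFun_eq_of_forall_le hx h).symm⟩

theorem supportFace_nonempty (K : ConvexBody Plane) (u : Plane) : (supportFace K u).Nonempty := by
  obtain ⟨x, hx, h⟩ := exists_forall_inner_le K u
  exact ⟨x, mem_supportFace.2 ⟨hx, h⟩⟩

theorem mem_middleSet {K : ConvexBody Plane} {z u : Plane} :
    z ∈ middleSet K u ↔
      ∃ x ∈ supportFace K u, ∃ y ∈ supportFace K (-u), (1 / 2 : ℝ) • (x + y) = z := by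
  simp only [middleSet, mem_smul_set, Set.mem_add]
  constructor
  · rintro ⟨_, ⟨x, hx, y, hy, rfl⟩, rfl⟩
    exact ⟨x, hx, y, hy, rfl⟩
  · rintro ⟨x, hx, y, hy, rfl⟩
    exact ⟨_, ⟨x, hx, y, hy, rfl⟩, rfl⟩

theorem middleSet_nonempty (K : ConvexBody Plane) (u : Plane) : (middleSet K u).Nonempty := by
  obtain ⟨x, hx⟩ := supportFace_nonempty K u
  obtain ⟨y, hy⟩ := supportFace_nonempty K (-u)
  exact ⟨_, mem_middleSet.2 ⟨x, hx, y, hy, rfl⟩⟩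

theorem mem_middleHedgehog {K : ConvexBody Plane} {z : Plane} :
    z ∈ middleHedgehog K ↔ ∃ u : Plane, ‖u‖ = 1 ∧ z ∈ middleSet K u := by
  simp [middleHedgehog]

theorem supportFace_smul (K : ConvexBody Plane) (u : Plane) {c : ℝ} (hc : 0 < c) :
    supportFace K (c • u) = supportFace K u := by
  ext x
  simp [mem_supportFace, inner_smul_right, hc]

theorem middleSet_smul (K : ConvexBody Plane) (u : Plane) {c : ℝ} (hc : 0 < c) :
    middleSet K (c • u) = middleSet K u := by
  rw [middleSet, middleSet, ← smul_neg, supportFace_smul _ _ hc, supportFace_smul _ _ hc]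

theorem middleSet_subset_middleHedgehog (K : ConvexBody Plane) {u : Plane} (hu : u ≠ 0) :
    middleSet K u ⊆ middleHedgehog K := by
  intro z hz
  refine mem_middleHedgehog.2 ⟨‖u‖⁻¹ • u, norm_smul_inv_norm hu, ?_⟩
  rwa [middleSet_smul _ _ (by positivity)]

theorem mem_supportFace_add {K L : ConvexBody Plane} {x y u : Plane} (hx : x ∈ supportFace K u)
    (hy : y ∈ supportFace L u) : x + y ∈ supportFace (K + L) u := by
  rw [mem_supportFace] at *
  refine ⟨Set.add_mem_add hx.1 hy.1, ?_⟩
  rintro _ ⟨a, ha, b, hb, rfl⟩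
  simp only [inner_add_left]
  exact add_le_add (hx.2 a ha) (hy.2 b hb)

theorem supportFace_add (K L : ConvexBody Plane) (u : Plane) :
    supportFace (K + L) u = supportFace K u + supportFace L u := by
  apply Subset.antisymm
  · intro z hz
    obtain ⟨hz, h⟩ := mem_supportFace.1 hz
    obtain ⟨x, hx, y, hy, rfl⟩ := hz
    refine ⟨x, mem_supportFace.2 ⟨hx, fun a ha => ?_⟩, y, mem_supportFace.2 ⟨hy, fun b hb => ?_⟩,
      rfl⟩
    · have := h (a + y) (Set.add_mem_add ha hy)
      simpa [inner_add_left] using this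
    · have := h (x + b) (Set.add_mem_add hx hb)
      simpa [inner_add_left] using this
  · rintro _ ⟨x, hx, y, hy, rfl⟩
    exact mem_supportFace_add hx hy

/-- Additivity for a fixed normal is what lets small summands modify the hedgehog in a controlled
way. -/
theorem middleSet_add (K L : ConvexBody Plane) (u : Plane) :
    middleSet (K + L) u = middleSet K u + middleSet L u := by
  rw [middleSet, middleSet, middleSet, supportFace_add, supportFace_add, ← smul_add]
  congr 1
  exact add_add_add_comm _ _ _ _

theorem middleSet_zero (u : Plane) : middleSet 0 u = {0} := by
  have h0 : ∀ v : Plane, supportFace 0 v = {0} := by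
    intro v
    refine (supportFace_nonempty 0 v).subset_singleton_iff.1 ?_
    intro x hx
    exact (mem_supportFace.1 hx).1
  rw [middleSet, h0, h0]
  simp

theorem middleSet_sum {ι : Type*} (s : Finset ι) (A : ι → ConvexBody Plane) (u : Plane) :
    middleSet (∑ i ∈ s, A i) u = ∑ i ∈ s, middleSet (A i) u := by
  classical
  induction s using Finset.induction_on with
  | empty => exact middleSet_zero u
  | insert i s hi ih => rw [Finset.sum_insert hi, Finset.sum_insert hi, middleSet_add, ih]

theorem exists_mem_dist_le_of_mem (K L : ConvexBody Plane) {x : Plane} (hx : x ∈ K) :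
    ∃ y ∈ L, dist x y ≤ dist K L := by
  obtain ⟨y, hy, h⟩ := L.isCompact.exists_infDist_eq_dist L.nonempty x
  refine ⟨y, hy, h ▸ ?_⟩
  exact infDist_le_hausdorffDist_of_mem hx ConvexBody.hausdorffEDist_ne_top

theorem isClosed_setOf_mem_supportFace :
    IsClosed {q : ConvexBody Plane × Plane × Plane | q.2.2 ∈ supportFace q.1 q.2.1} := by
  apply IsSeqClosed.isClosed
  rintro q ⟨K, u, x⟩ hq hlim
  have hK : Tendsto (fun n => dist (q n).1 K) atTop (𝓝 0) := by
    have := (continuous_fst.tendsto _).comp hlim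
    exact tendsto_iff_dist_tendsto_zero.1 this
  have hu : Tendsto (fun n => (q n).2.1) atTop (𝓝 u) :=
    ((continuous_fst.comp continuous_snd).tendsto _).comp hlim
  have hx : Tendsto (fun n => (q n).2.2) atTop (𝓝 x) :=
    ((continuous_snd.comp continuous_snd).tendsto _).comp hlim
  simp only [mem_ofPred_eq, mem_supportFace] at hq ⊢
  constructor
  · choose y hyK hy using fun n => exists_mem_dist_le_of_mem (q n).1 K (hq n).1
    refine K.isClosed.mem_of_tendsto (f := y) (b := atTop) ?_ (Eventually.of_forall hyK)
    have h0 : Tendsto (fun n => dist (q n).2.2 (y n)) atTop (𝓝 0) :=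
      squeeze_zero (fun _ => dist_nonneg) hy hK
    exact (tendsto_iff_of_dist h0).1 hx
  · intro y hy
    choose z hzK hz using fun n => exists_mem_dist_le_of_mem K (q n).1 hy
    have h0 : Tendsto z atTop (𝓝 y) := by
      rw [tendsto_iff_dist_tendsto_zero]
      refine squeeze_zero (fun _ => dist_nonneg) (fun n => ?_) hK
      rw [dist_comm, dist_comm (q n).1]
      exact hz n
    exact le_of_tendsto_of_tendsto' (h0.inner hu) (hx.inner hu) fun n => (hq n).2 _ (hzK n)

/-- A convergent sequence of bodies lies in a common ball, so the witnesses range over a compact set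
and a subsequence converges to witnesses for the limit. All semicontinuity statements below are
instances with a suitable `Φ`. -/
theorem isClosed_setOf_exists_unit_mem {Φ : Set (ConvexBody Plane × Plane × Plane × Plane)}
    (hΦ : IsClosed Φ) :
    IsClosed {K : ConvexBody Plane | ∃ u : Plane, ‖u‖ = 1 ∧ ∃ x ∈ K, ∃ y ∈ K, (K, u, x, y) ∈ Φ} := by
  apply IsSeqClosed.isClosed
  intro q K hq hlim
  choose u hu x hx y hy hmem using hq
  obtain ⟨R, hR⟩ := K.isBounded.exists_norm_le
  obtain ⟨D, hD⟩ := ((tendsto_iff_dist_tendsto_zero.1 hlim).isBoundedUnder_le).bddAbove_range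
  have hbound : ∀ n, ∀ z ∈ q n, z ∈ closedBall (0 : Plane) (R + D) := by
    intro n z hz
    obtain ⟨w, hw, hzw⟩ := exists_mem_dist_le_of_mem (q n) K hz
    rw [mem_closedBall_zero_iff]
    have h1 : dist (q n) K ≤ D := hD ⟨n, rfl⟩
    have h2 := hR w hw
    have h3 : ‖z‖ ≤ ‖w‖ + dist z w := by
      rw [dist_eq_norm]
      simpa using norm_add_le w (z - w)
    linarith
  have hc : IsCompact (sphere (0 : Plane) 1 ×ˢ
      (closedBall (0 : Plane) (R + D) ×ˢ closedBall (0 : Plane) (R + D))) :=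
    (isCompact_sphere _ _).prod ((isCompact_closedBall _ _).prod (isCompact_closedBall _ _))
  obtain ⟨⟨v, a, b⟩, ⟨hv, -, -⟩, φ, hφ, hconv⟩ := hc.tendsto_subseq
    (x := fun n => (u n, x n, y n))
    fun n => ⟨by simpa using hu n, hbound n _ (hx n), hbound n _ (hy n)⟩
  have hK := hlim.comp hφ.tendsto_atTop
  have hmem' : (K, v, a, b) ∈ Φ :=
    hΦ.mem_of_tendsto (hK.prodMk_nhds hconv) (Eventually.of_forall fun n => hmem _)
  have hin : ∀ (z : ℕ → Plane) (c : Plane), (∀ n, z n ∈ q (φ n)) → Tendsto z atTop (𝓝 c) →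
      c ∈ K := by
    intro z c hz hzc
    have := isClosed_setOf_mem_supportFace.mem_of_tendsto (x := (K, (0 : Plane), c)) (b := atTop)
      (f := fun n => (q (φ n), (0 : Plane), z n))
      (hK.prodMk_nhds (tendsto_const_nhds.prodMk_nhds hzc))
      (Eventually.of_forall fun n => mem_supportFace.2 ⟨hz n, by simp⟩)
    exact (mem_supportFace.1 this).1
  exact ⟨v, by simpa using hv, a,
    hin _ _ (fun n => hx _) (((continuous_fst.comp continuous_snd).tendsto _).comp hconv), b,
    hin _ _ (fun n => hy _) (((continuous_snd.comp continuous_snd).tendsto _).comp hconv), hmem'⟩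

theorem isCompact_middleHedgehog (K : ConvexBody Plane) : IsCompact (middleHedgehog K) := by
  have hc : IsCompact (sphere (0 : Plane) 1 ×ˢ ((K : Set Plane) ×ˢ (K : Set Plane))) :=
    (isCompact_sphere _ _).prod (K.isCompact.prod K.isCompact)
  have hcl : IsClosed {q : Plane × Plane × Plane |
      q.2.1 ∈ supportFace K q.1 ∧ q.2.2 ∈ supportFace K (-q.1)} :=
    (isClosed_setOf_mem_supportFace.preimage
      (f := fun q : Plane × Plane × Plane => (K, q.1, q.2.1)) (by fun_prop)).inter
    (isClosed_setOf_mem_supportFace.preimage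
      (f := fun q : Plane × Plane × Plane => (K, -q.1, q.2.2)) (by fun_prop))
  convert (hc.inter_right hcl).image
    (f := fun q : Plane × Plane × Plane => (1 / 2 : ℝ) • (q.2.1 + q.2.2)) (by fun_prop) using 1
  ext z
  simp only [mem_middleHedgehog, mem_middleSet, mem_image]
  constructor
  · rintro ⟨u, hu, x, hx, y, hy, rfl⟩
    exact ⟨(u, x, y), ⟨⟨by simpa using hu, hx.1, hy.1⟩, hx, hy⟩, rfl⟩
  · rintro ⟨⟨u, x, y⟩, ⟨⟨hu, -, -⟩, hx, hy⟩, rfl⟩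
    exact ⟨u, by simpa using hu, x, hx, y, hy, rfl⟩

theorem isClosed_setOf_exists_midpoint_mem {C : Set (Plane × Plane)} (hC : IsClosed C) :
    IsClosed {K : ConvexBody Plane | ∃ u : Plane, ‖u‖ = 1 ∧ ∃ z ∈ middleSet K u, (u, z) ∈ C} := by
  have hΦ : IsClosed {q : ConvexBody Plane × Plane × Plane × Plane |
      q.2.2.1 ∈ supportFace q.1 q.2.1 ∧ q.2.2.2 ∈ supportFace q.1 (-q.2.1) ∧
        (q.2.1, (1 / 2 : ℝ) • (q.2.2.1 + q.2.2.2)) ∈ C} := by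
    refine IsClosed.inter (isClosed_setOf_mem_supportFace.preimage
      (f := fun q : ConvexBody Plane × Plane × Plane × Plane => (q.1, q.2.1, q.2.2.1))
      (by fun_prop)) (IsClosed.inter (isClosed_setOf_mem_supportFace.preimage
      (f := fun q : ConvexBody Plane × Plane × Plane × Plane => (q.1, -q.2.1, q.2.2.2))
      (by fun_prop)) (hC.preimage (by fun_prop)))
  convert isClosed_setOf_exists_unit_mem hΦ using 1
  ext K
  simp only [mem_ofPred_eq, mem_middleSet]
  constructor
  · rintro ⟨u, hu, z, ⟨x, hx, y, hy, rfl⟩, hz⟩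
    exact ⟨u, hu, x, hx.1, y, hy.1, hx, hy, hz⟩
  · rintro ⟨u, hu, x, -, y, -, hx, hy, hz⟩
    exact ⟨u, hu, _, ⟨x, hx, y, hy, rfl⟩, hz⟩

theorem eventually_middleHedgehog_subset_thickening (K : ConvexBody Plane) {η : ℝ} (hη : 0 < η) :
    ∀ᶠ L in 𝓝 K, middleHedgehog L ⊆ thickening η (middleHedgehog K) := by
  have hcl := isClosed_setOf_exists_midpoint_mem
    (C := {q | q.2 ∉ thickening η (middleHedgehog K)})
    (isOpen_thickening.isClosed_compl.preimage continuous_snd)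
  have hK : K ∈ {L : ConvexBody Plane | ∃ u : Plane, ‖u‖ = 1 ∧ ∃ z ∈ middleSet L u,
      (u, z) ∈ {q : Plane × Plane | q.2 ∉ thickening η (middleHedgehog K)}}ᶜ := by
    rintro ⟨u, hu, z, hz, h⟩
    exact h (self_subset_thickening hη _ (mem_middleHedgehog.2 ⟨u, hu, hz⟩))
  filter_upwards [hcl.isOpen_compl.mem_nhds hK] with L hL z hz
  by_contra h
  obtain ⟨u, hu, hz⟩ := mem_middleHedgehog.1 hz
  exact hL ⟨u, hu, z, hz, h⟩

/-- Lower semicontinuity at a normal with one-point middle set: having a midpoint for this same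
normal at distance at least `η` from `p` is a closed condition that `K` violates, and middle sets
are never empty. -/
theorem eventually_exists_mem_middleHedgehog {K : ConvexBody Plane} {u p : Plane} (hu : u ≠ 0)
    (hp : middleSet K u = {p}) {η : ℝ} (hη : 0 < η) :
    ∀ᶠ L in 𝓝 K, ∃ z ∈ middleHedgehog L, dist z p < η := by
  set w := ‖u‖⁻¹ • u with hw
  have hw1 : ‖w‖ = 1 := norm_smul_inv_norm hu
  rw [← middleSet_smul K u (c := ‖u‖⁻¹) (by positivity), ← hw] at hp
  have hcl := isClosed_setOf_exists_midpoint_mem (C := {w} ×ˢ (ball p η)ᶜ)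
    (isClosed_singleton.prod isOpen_ball.isClosed_compl)
  have hK : K ∈ {L : ConvexBody Plane | ∃ u : Plane, ‖u‖ = 1 ∧ ∃ z ∈ middleSet L u,
      (u, z) ∈ ({w} ×ˢ (ball p η)ᶜ : Set (Plane × Plane))}ᶜ := by
    rintro ⟨u', -, z, hz, hu', h⟩
    obtain rfl : u' = w := hu'
    rw [hp] at hz
    rw [mem_singleton_iff.1 hz] at h
    exact h (mem_ball_self hη)
  filter_upwards [hcl.isOpen_compl.mem_nhds hK] with L hL
  obtain ⟨z, hz⟩ := middleSet_nonempty L w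
  refine ⟨z, mem_middleHedgehog.2 ⟨w, hw1, hz⟩, ?_⟩
  by_contra h
  exact hL ⟨w, hw1, z, hz, rfl, h⟩

theorem strictConvex_iff_supportFace_subsingleton (K : ConvexBody Plane) :
    StrictConvex ℝ (K : Set Plane) ↔ ∀ u : Plane, ‖u‖ = 1 → (supportFace K u).Subsingleton := by
  constructor
  · intro hK u hu x hx y hy
    by_contra hxy
    rw [mem_supportFace] at hx hy
    have hint := hK hx.1 hy.1 hxy (a := 1 / 2) (b := 1 / 2) (by norm_num) (by norm_num)
      (by norm_num)
    obtain ⟨ε, hε, hball⟩ := Metric.isOpen_iff.1 isOpen_interior _ hint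
    have hmem : (1 / 2 : ℝ) • x + (1 / 2 : ℝ) • y + (ε / 2) • u ∈ K := by
      apply interior_subset
      apply hball
      simp [norm_smul, hu, abs_of_pos hε, hε]
    have h1 := hx.2 _ hmem
    have h2 := hy.2 _ hx.1
    have h3 := hx.2 _ hy.1
    simp only [inner_add_left, inner_smul_left, real_inner_self_eq_norm_sq, hu] at h1
    norm_num at h1
    linarith
  · intro h x hx y hy hxy a b ha hb hab
    by_contra hint
    set z := a • x + b • y with hz
    -- A supporting line at `z` arises as a limit of lines separating `K` from outside points
    -- tending to `z`. This also covers bodies with empty interior.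
    have hz' : z ∈ closure (K : Set Plane)ᶜ := by rwa [closure_compl]
    obtain ⟨w, hwK, hw⟩ := mem_closure_iff_seq_limit.1 hz'
    have hsep : ∀ n, ∃ u : Plane, ‖u‖ = 1 ∧ ∀ c ∈ K, inner ℝ c u ≤ inner ℝ (w n) u := by
      intro n
      obtain ⟨f, t, h1, h2⟩ := geometric_hahn_banach_closed_point K.convex K.isClosed (hwK n)
      obtain ⟨v, rfl⟩ := (InnerProductSpace.toDual ℝ Plane).surjective f
      simp only [InnerProductSpace.toDual_apply_apply] at h1 h2
      have hv : v ≠ 0 := by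
        rintro rfl
        have := h1 x hx
        simp at this h2
        linarith
      refine ⟨‖v‖⁻¹ • v, norm_smul_inv_norm hv, fun c hc => ?_⟩
      rw [inner_smul_right, inner_smul_right, real_inner_comm, real_inner_comm v]
      have := h1 c hc
      gcongr
      linarith
    choose u hu hsup using hsep
    obtain ⟨v, hv, φ, hφ, hconv⟩ := (isCompact_sphere (0 : Plane) 1).tendsto_subseq (x := u)
      (fun n => by simpa using hu n)
    have hsupv : ∀ c ∈ K, inner ℝ c v ≤ inner ℝ z v := fun c hc =>
      le_of_tendsto_of_tendsto' (tendsto_const_nhds.inner hconv)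
        ((hw.comp hφ.tendsto_atTop).inner hconv) fun n => hsup _ c hc
    have hxv := hsupv x hx
    have hyv := hsupv y hy
    have hzv : inner ℝ z v = a * inner ℝ x v + b * inner ℝ y v := by
      simp [hz, inner_add_left, inner_smul_left]
    obtain rfl : a = 1 - b := by linarith
    have hxy' : inner ℝ x v = inner ℝ y v := by
      apply le_antisymm <;> by_contra! hlt <;> nlinarith
    have hzx : inner ℝ z v = inner ℝ x v := by rw [hzv, ← hxy']; ring
    apply hxy
    apply h v (by simpa using hv)
    · exact mem_supportFace.2 ⟨hx, fun c hc => hzx ▸ hsupv c hc⟩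
    · exact mem_supportFace.2 ⟨hy, fun c hc => hxy' ▸ hzx ▸ hsupv c hc⟩

theorem middleSet_eq_singleton_of_strictConvex {K : ConvexBody Plane}
    (hK : StrictConvex ℝ (K : Set Plane)) {u z : Plane} (hu : ‖u‖ = 1) (hz : z ∈ middleSet K u) :
    middleSet K u = {z} := by
  rw [strictConvex_iff_supportFace_subsingleton] at hK
  refine Subset.antisymm ?_ (by simpa using hz)
  obtain ⟨x, hx, y, hy, rfl⟩ := mem_middleSet.1 hz
  intro w hw
  obtain ⟨x', hx', y', hy', rfl⟩ := mem_middleSet.1 hw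
  rw [hK u hu hx hx', hK (-u) (by simpa using hu) hy hy']
  rfl

/-- The complement is the union over `n` of the closed sets of bodies having a face that contains
two points at distance at least `1 / (n + 1)`. -/
theorem isGδ_setOf_strictConvex :
    IsGδ {K : ConvexBody Plane | StrictConvex ℝ (K : Set Plane)} := by
  have hcl : ∀ n : ℕ, IsClosed {K : ConvexBody Plane | ∃ u : Plane, ‖u‖ = 1 ∧ ∃ x ∈ K, ∃ y ∈ K,
      (K, u, x, y) ∈ {q : ConvexBody Plane × Plane × Plane × Plane |
        q.2.2.1 ∈ supportFace q.1 q.2.1 ∧ q.2.2.2 ∈ supportFace q.1 q.2.1 ∧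
          1 / ((n : ℝ) + 1) ≤ dist q.2.2.1 q.2.2.2}} := by
    intro n
    apply isClosed_setOf_exists_unit_mem
    refine IsClosed.inter (isClosed_setOf_mem_supportFace.preimage
      (f := fun q : ConvexBody Plane × Plane × Plane × Plane => (q.1, q.2.1, q.2.2.1))
      (by fun_prop)) (IsClosed.inter (isClosed_setOf_mem_supportFace.preimage
      (f := fun q : ConvexBody Plane × Plane × Plane × Plane => (q.1, q.2.1, q.2.2.2))
      (by fun_prop)) 
      (isClosed_le continuous_const (g := fun q : ConvexBody Plane × Plane × Plane × Plane =>
        dist q.2.2.1 q.2.2.2) (by fun_prop)))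
  convert IsGδ.iInter_of_isOpen fun n => (hcl n).isOpen_compl using 1
  ext K
  simp only [mem_ofPred_eq, strictConvex_iff_supportFace_subsingleton, mem_iInter, mem_compl_iff]
  constructor
  · rintro h n ⟨u, hu, x, -, y, -, hx, hy, hd⟩
    rw [h u hu hx hy, dist_self] at hd
    exact absurd hd (not_le.2 (by positivity))
  · intro h u hu x hx y hy
    by_contra hxy
    obtain ⟨n, hn⟩ := exists_nat_one_div_lt (dist_pos.2 hxy)
    exact h n ⟨u, hu, x, hx.1, y, hy.1, hx, hy, hn.le⟩

end SupportFaces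

/-! ### Stability of exposed points of convex hulls of compact planar sets. -/

section ExposedPoints

open Set Metric Filter Topology

theorem exists_gap {C : Set Plane} (hC : IsCompact C) {p v : Plane} {s c : ℝ}
    (h : ∀ z ∈ C, s ≤ dist z p → inner ℝ z v < c) :
    ∃ δ > 0, ∀ z ∈ C, s ≤ dist z p → inner ℝ z v ≤ c - δ := by
  have hc : IsCompact (C ∩ {z | s ≤ dist z p}) :=
    hC.inter_right (isClosed_le continuous_const (by fun_prop))
  rcases (C ∩ {z | s ≤ dist z p}).eq_empty_or_nonempty with he | hne
  · refine ⟨1, one_pos, fun z hz hs => ?_⟩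
    have : z ∈ C ∩ {z | s ≤ dist z p} := ⟨hz, hs⟩
    simp [he] at this
  · obtain ⟨m, hm, hmax⟩ := hc.exists_isMaxOn hne (f := fun z : Plane => inner ℝ z v) (by fun_prop)
    refine ⟨c - inner ℝ m v, sub_pos.2 (h m hm.1 hm.2), fun z hz hs => ?_⟩
    have := hmax (show z ∈ C ∩ {z | s ≤ dist z p} from ⟨hz, hs⟩)
    simp only [mem_ofPred_eq] at this
    linarith

/-- The ball about `q` through `x` contains the hull, and its tangent line at `x` meets it only
there. -/
theorem mem_exposedPoints_convexHull_of_farthest {C : Set Plane} {x q : Plane} (hx : x ∈ C)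
    (h : ∀ z ∈ C, dist z q ≤ dist x q) : x ∈ exposedPoints ℝ (convexHull ℝ C) := by
  have hsub : convexHull ℝ C ⊆ closedBall q (dist x q) :=
    convexHull_min (fun z hz => h z hz) (convex_closedBall _ _)
  refine ⟨subset_convexHull ℝ C hx, innerSL ℝ (x - q), fun y hy => ?_⟩
  have hyq : ‖y - q‖ ≤ ‖x - q‖ := by simpa [dist_eq_norm] using hsub hy
  have hyq2 : ‖y - q‖ ^ 2 ≤ ‖x - q‖ ^ 2 := by gcongr
  have key : ‖x - y‖ ^ 2 = ‖y - q‖ ^ 2 - ‖x - q‖ ^ 2 + 2 * inner ℝ (x - q) (x - y) := by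
    have h2 := norm_sub_sq_real (x - q) (x - y)
    rw [show x - q - (x - y) = y - q by abel] at h2
    linarith
  rw [inner_sub_right] at key
  simp only [innerSL_apply_apply]
  refine ⟨by nlinarith [sq_nonneg ‖x - y‖], fun hle => ?_⟩
  have h0 : ‖x - y‖ ^ 2 ≤ 0 := by linarith
  have h1 : ‖x - y‖ = 0 := by
    have := sq_nonneg ‖x - y‖
    exact pow_eq_zero_iff (two_ne_zero) |>.1 (le_antisymm h0 this)
  exact (sub_eq_zero.1 (norm_eq_zero.1 h1)).symm

/-- The cap of `C` cut off through `x` in direction `v` lies in a small ball. A farthest point of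
`C` from a centre very far out in direction `-v` is exposed, and must lie in that ball. -/
theorem exists_mem_exposedPoints_dist_lt {C : Set Plane} (hC : IsCompact C) {x v p : Plane} {r : ℝ}
    (hx : x ∈ C) (h : ∀ z ∈ C, inner ℝ x v ≤ inner ℝ z v → dist z p < r) :
    ∃ y ∈ exposedPoints ℝ (convexHull ℝ C), dist y p < r := by
  obtain ⟨δ, hδ, hgap⟩ := exists_gap hC (p := p) (v := v) (s := r) (c := inner ℝ x v)
    fun z hz hs => by
      by_contra! hle
      exact absurd (h z hz hle) (not_lt.2 hs)
  obtain ⟨B, hB⟩ := hC.isBounded.exists_norm_le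
  -- A farthest point outside the ball would give `2 * R * δ ≤ B ^ 2`, which this choice of `R`
  -- excludes.
  set R := (B ^ 2 + 1) / δ with hR
  have hRδ : R * δ = B ^ 2 + 1 := by rw [hR]; field_simp
  obtain ⟨y, hy, hmax⟩ := hC.exists_isMaxOn ⟨x, hx⟩ (f := fun z : Plane => dist z (-(R • v)))
    (by fun_prop)
  refine ⟨y, mem_exposedPoints_convexHull_of_farthest hy fun z hz => hmax hz, ?_⟩
  by_contra! hyp
  have h1 : ‖x + R • v‖ ^ 2 ≤ ‖y + R • v‖ ^ 2 := by
    have : dist x (-(R • v)) ≤ dist y (-(R • v)) := hmax hx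
    simp only [dist_eq_norm, sub_neg_eq_add] at this
    gcongr
  rw [norm_add_sq_real, norm_add_sq_real, inner_smul_right, inner_smul_right] at h1
  have h2 := hgap y hy hyp
  have h3 : ‖y‖ ^ 2 ≤ B ^ 2 := by
    have := hB y hy
    gcongr
  have hR0 : 0 ≤ R := by positivity
  nlinarith [sq_nonneg ‖x‖, mul_le_mul_of_nonneg_left h2 hR0, sq_nonneg B]

theorem eventually_exists_mem_exposedPoints {C : Set Plane} (hC : IsCompact C) {x v : Plane}
    (hexp : ∀ z ∈ C, z ≠ x → inner ℝ z v < inner ℝ x v) {r : ℝ} (hr : 0 < r) :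
    ∀ᶠ η in 𝓝[>] (0 : ℝ), ∀ C' : Set Plane, IsCompact C' → C' ⊆ thickening η C →
      (∃ x' ∈ C', dist x' x < η) → ∃ y ∈ exposedPoints ℝ (convexHull ℝ C'), dist y x < r := by
  obtain ⟨δ, hδ, hgap⟩ := exists_gap hC (p := x) (v := v) (s := r / 2) (c := inner ℝ x v)
    fun z hz hs => hexp z hz (by rintro rfl; simp at hs; linarith)
  have h1 : ∀ᶠ η in 𝓝[>] (0 : ℝ), η < r / 2 :=
    nhdsWithin_le_nhds (gt_mem_nhds (by positivity))
  have h2 : ∀ᶠ η in 𝓝[>] (0 : ℝ), 2 * ‖v‖ * η < δ := by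
    refine nhdsWithin_le_nhds ?_
    have : Tendsto (fun η : ℝ => 2 * ‖v‖ * η) (𝓝 0) (𝓝 (2 * ‖v‖ * 0)) :=
      (continuous_const.mul continuous_id).tendsto _
    rw [mul_zero] at this
    exact this.eventually_lt_const hδ
  have hinner : ∀ (a b : Plane) (η : ℝ), dist a b < η → inner ℝ a v ≤ inner ℝ b v + ‖v‖ * η := by
    intro a b η hab
    have := real_inner_le_norm (a - b) v
    rw [inner_sub_left, ← dist_eq_norm] at this
    nlinarith [norm_nonneg v]
  filter_upwards [h1, h2] with η hη1 hη2 C' hC' hsub ⟨x', hx', hd⟩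
  refine exists_mem_exposedPoints_dist_lt hC' (v := v) hx' fun z' hz' hle => ?_
  by_contra! hzr
  obtain ⟨z, hz, hzz⟩ := mem_thickening_iff.1 (hsub hz')
  have hzx : r / 2 ≤ dist z x := by
    have := dist_triangle z' z x
    linarith
  have a1 := hgap z hz hzx
  have a2 := hinner _ _ _ hzz
  rw [dist_comm] at hd
  have a3 := hinner _ _ _ hd
  linarith

theorem exists_forall_le_encard_exposedPoints {C : Set Plane} (hC : IsCompact C) {n : ℕ}
    {x v : Fin n → Plane} (hx : Function.Injective x)
    (hexp : ∀ i, ∀ z ∈ C, z ≠ x i → inner ℝ z (v i) < inner ℝ (x i) (v i)) :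
    ∃ η > 0, ∀ C' : Set Plane, IsCompact C' → C' ⊆ thickening η C →
      (∀ i, ∃ x' ∈ C', dist x' (x i) < η) →
        (n : ℕ∞) ≤ (exposedPoints ℝ (convexHull ℝ C')).encard := by
  have hsep : ∀ᶠ r in 𝓝[>] (0 : ℝ), ∀ i j, i ≠ j → 2 * r < dist (x i) (x j) := by
    refine eventually_all.2 fun i => eventually_all.2 fun j => ?_
    by_cases hij : i = j
    · simp [hij]
    · have hpos : 0 < dist (x i) (x j) / 2 := half_pos (dist_pos.2 (hx.ne hij))
      filter_upwards [nhdsWithin_le_nhds (gt_mem_nhds hpos)] with r hr _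
      linarith
  obtain ⟨r, hr, hr0⟩ := (hsep.and self_mem_nhdsWithin).exists
  have hev := eventually_all.2 fun i => eventually_exists_mem_exposedPoints hC (hexp i) hr0
  obtain ⟨η, hη, hη0⟩ := (hev.and self_mem_nhdsWithin).exists
  refine ⟨η, hη0, fun C' hC' hsub hnear => ?_⟩
  choose y hy hyx using fun i => hη i C' hC' hsub (hnear i)
  have hinj : Function.Injective y := by
    intro i j hij
    by_contra hne
    have h1 := hr i j hne
    have h2 := hyx i
    have h3 := hyx j
    rw [← hij] at h3
    have := dist_triangle_left (x i) (x j) (y i)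
    linarith
  calc (n : ℕ∞) = (range y).encard := by
        rw [← image_univ, hinj.encard_image]; simp
    _ ≤ _ := encard_le_encard (range_subset_iff.2 hy)

theorem exists_injective_of_le_encard {s : Set Plane} {n : ℕ} (h : (n : ℕ∞) ≤ s.encard) :
    ∃ x : Fin n → Plane, Function.Injective x ∧ ∀ i, x i ∈ s := by
  obtain ⟨t, hts, ht⟩ := exists_subset_encard_eq h
  have hfin : t.Finite := finite_of_encard_eq_coe ht
  have hcard : hfin.toFinset.card = n := by
    rw [hfin.encard_eq_coe_toFinset_card] at ht
    exact_mod_cast ht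
  refine ⟨fun i => (hfin.toFinset.equivFinOfCardEq hcard).symm i,
    Subtype.val_injective.comp (Equiv.injective _), fun i => hts ?_⟩
  exact hfin.mem_toFinset.1 ((hfin.toFinset.equivFinOfCardEq hcard).symm i).2

/-- Strict convexity enters through one-point middle sets: each of `k + 1` exposed points is a
midpoint, and so is approximated by midpoints of every nearby body. -/
theorem isClosed_setOf_encard_hedgehogExposedPoints_le (k : ℕ) :
    IsClosed {K : StrictlyConvexBody | (hedgehogExposedPoints K.1).encard ≤ k} := by
  rw [← isOpen_compl_iff, isOpen_iff_mem_nhds]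
  intro K hK
  have hK' : ((k + 1 : ℕ) : ℕ∞) ≤ (hedgehogExposedPoints K.1).encard := by
    have : (k : ℕ∞) < (hedgehogExposedPoints K.1).encard := not_le.1 hK
    exact_mod_cast Order.add_one_le_of_lt this
  obtain ⟨x, hxinj, hx⟩ := exists_injective_of_le_encard hK'
  have hmem : ∀ i, x i ∈ middleHedgehog K.1 := fun i =>
    extremePoints_convexHull_subset (exposedPoints_subset_extremePoints (hx i))
  have hv : ∀ i, ∃ v : Plane, ∀ z ∈ middleHedgehog K.1, z ≠ x i →
      inner ℝ z v < inner ℝ (x i) v := by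
    intro i
    obtain ⟨-, l, hl⟩ := hx i
    obtain ⟨v, rfl⟩ := (InnerProductSpace.toDual ℝ Plane).surjective l
    refine ⟨v, fun z hz hne => ?_⟩
    have := hl z (subset_convexHull ℝ _ hz)
    simp only [InnerProductSpace.toDual_apply_apply] at this
    rw [real_inner_comm, real_inner_comm v]
    exact lt_of_not_ge fun hle => hne (this.2 hle)
  choose v hv using hv
  obtain ⟨η, hη, hall⟩ := exists_forall_le_encard_exposedPoints
    (isCompact_middleHedgehog K.1) hxinj hv
  have hnear : ∀ i, ∀ᶠ L in 𝓝 K.1, ∃ z ∈ middleHedgehog L, dist z (x i) < η := by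
    intro i
    obtain ⟨u, hu, hz⟩ := mem_middleHedgehog.1 (hmem i)
    exact eventually_exists_mem_middleHedgehog (norm_ne_zero_iff.1 (hu ▸ one_ne_zero))
      (middleSet_eq_singleton_of_strictConvex K.2 hu hz) hη
  have hev := (eventually_middleHedgehog_subset_thickening K.1 hη).and (eventually_all.2 hnear)
  filter_upwards [continuous_subtype_val.continuousAt.eventually hev] with L hL
  have h1 := hall _ (isCompact_middleHedgehog L.1) hL.1 hL.2
  refine not_le.2 (lt_of_lt_of_le ?_ h1)
  exact_mod_cast Nat.lt_succ_self k

end ExposedPoints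

/-! ### Density of strictly convex bodies. -/

section StrictlyConvexApproximation

open Set Metric Filter Topology

theorem infDist_convex_combination_le (K : ConvexBody Plane) (x y : Plane) {a b : ℝ} (ha : 0 ≤ a)
    (hb : 0 ≤ b) (hab : a + b = 1) :
    infDist (a • x + b • y) (K : Set Plane) ≤
      a * infDist x (K : Set Plane) + b * infDist y (K : Set Plane) := by
  obtain ⟨x', hx', hxd⟩ := K.isCompact.exists_infDist_eq_dist K.nonempty x
  obtain ⟨y', hy', hyd⟩ := K.isCompact.exists_infDist_eq_dist K.nonempty y
  refine (infDist_le_dist_of_mem (K.convex hx' hy' ha hb hab)).trans ?_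
  rw [hxd, hyd]
  refine (dist_add_add_le _ _ _ _).trans ?_
  rw [dist_smul₀, dist_smul₀, Real.norm_of_nonneg ha, Real.norm_of_nonneg hb]

theorem norm_sq_convex_combination (x y : Plane) {a b : ℝ} (hab : a + b = 1) :
    ‖a • x + b • y‖ ^ 2 = a * ‖x‖ ^ 2 + b * ‖y‖ ^ 2 - a * b * ‖x - y‖ ^ 2 := by
  rw [norm_add_sq_real, norm_sub_sq_real, norm_smul, norm_smul, inner_smul_left, inner_smul_right,
    mul_pow, mul_pow, Real.norm_eq_abs, Real.norm_eq_abs, sq_abs, sq_abs]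
  obtain rfl : a = 1 - b := by linarith
  simp only [conj_trivial]
  ring

/-- Adding a small multiple of the squared norm to the convex function `infDist · K` makes it
strictly convex; a suitable sublevel set contains `K` and stays within its `T`-neighbourhood. -/
theorem exists_strictConvex_dist_lt (K : ConvexBody Plane) {ε : ℝ} (hε : 0 < ε) :
    ∃ L : ConvexBody Plane, StrictConvex ℝ (L : Set Plane) ∧ dist L K < ε := by
  obtain ⟨R, hR⟩ := K.isBounded.exists_norm_le
  set c := ε / 2 / (R ^ 2 + 1) with hc
  have hc0 : 0 < c := by positivity
  -- The smallest level guaranteed by `hR` to include all of `K`; the choice of `c` keeps it below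
  -- `ε`.
  set T := c * R ^ 2 with hT
  have hT0 : 0 ≤ T := by positivity
  have hTε : T < ε := by
    have : c * (R ^ 2 + 1) = ε / 2 := by rw [hc]; field_simp
    linarith
  set f : Plane → ℝ := fun x => infDist x (K : Set Plane) + c * ‖x‖ ^ 2 with hf
  have hfc : Continuous f := by
    have := continuous_infDist_pt (K : Set Plane)
    fun_prop
  have hlt : ∀ x y : Plane, x ≠ y → f x ≤ T → f y ≤ T → ∀ a b : ℝ, 0 < a → 0 < b → a + b = 1 →
      f (a • x + b • y) < T := by
    intro x y hxy hx hy a b ha hb hab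
    have h1 := infDist_convex_combination_le K x y ha.le hb.le hab
    have h2 := norm_sq_convex_combination x y hab
    have h3 : 0 < ‖x - y‖ := norm_pos_iff.2 (sub_ne_zero.2 hxy)
    have h4 : 0 < c * (a * b * ‖x - y‖ ^ 2) := by positivity
    calc f (a • x + b • y) ≤ a * f x + b * f y - c * (a * b * ‖x - y‖ ^ 2) := by
          simp only [hf, h2]; linarith
      _ < a * T + b * T := by
          linarith [mul_le_mul_of_nonneg_left hx ha.le, mul_le_mul_of_nonneg_left hy hb.le]
      _ = T := by rw [← add_mul, hab, one_mul]
  have hsc : StrictConvex ℝ {x | f x ≤ T} := by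
    intro x hx y hy hxy a b ha hb hab
    refine mem_interior.2 ⟨{x | f x < T}, fun z (hz : f z < T) => hz.le, isOpen_lt hfc continuous_const,
      hlt x y hxy hx hy a b ha hb hab⟩
  have hKL : (K : Set Plane) ⊆ {x | f x ≤ T} := by
    intro x hx
    have h1 := hR x hx
    have h2 : f x = c * ‖x‖ ^ 2 := by simp [hf, infDist_zero_of_mem hx]
    rw [mem_ofPred_eq, h2, hT]
    gcongr
  have hinf : ∀ x, f x ≤ T → infDist x (K : Set Plane) ≤ T := by
    intro x hx
    have : 0 ≤ c * ‖x‖ ^ 2 := by positivity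
    simp only [hf] at hx
    linarith
  have hcomp : IsCompact {x | f x ≤ T} := by
    refine (K.isCompact.cthickening (r := T)).of_isClosed_subset
      (isClosed_le hfc continuous_const) fun x hx => ?_
    obtain ⟨y, hy, hxy⟩ := K.isCompact.exists_infDist_eq_dist K.nonempty x
    exact mem_cthickening_of_dist_le x y T _ hy (hxy ▸ hinf x hx)
  refine ⟨⟨{x | f x ≤ T}, hsc.convex, hcomp, K.nonempty.mono hKL⟩, hsc, lt_of_le_of_lt ?_ hTε⟩
  refine hausdorffDist_le_of_infDist hT0 hinf fun x hx => ?_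
  exact (infDist_zero_of_mem (hKL hx)).trans_le hT0

theorem dense_setOf_strictConvex :
    Dense {K : ConvexBody Plane | StrictConvex ℝ (K : Set Plane)} := by
  refine Metric.dense_iff.2 fun K ε hε => ?_
  obtain ⟨L, hL, hd⟩ := exists_strictConvex_dist_lt K hε
  exact ⟨L, hd, hL⟩

end StrictlyConvexApproximation

/-! ### Plane geometry; faces and middle sets of polygons. -/

section Polygons

open Set Metric Filter Topology

/-- The counterclockwise rotation of the plane by a right angle. -/
noncomputable def quarterTurn (x : Plane) : Plane := !₂[-x 1, x 0]

@[simp]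
theorem quarterTurn_apply_zero (x : Plane) : quarterTurn x 0 = -x 1 := rfl

@[simp]
theorem quarterTurn_apply_one (x : Plane) : quarterTurn x 1 = x 0 := rfl

theorem plane_inner_eq (x y : Plane) : inner ℝ x y = x 0 * y 0 + x 1 * y 1 := by
  simp [PiLp.inner_apply, Fin.sum_univ_two, mul_comm]

theorem plane_norm_sq_eq (x : Plane) : ‖x‖ ^ 2 = x 0 * x 0 + x 1 * x 1 := by
  rw [← real_inner_self_eq_norm_sq, plane_inner_eq]

@[fun_prop]
theorem continuous_quarterTurn : Continuous quarterTurn := by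
  unfold quarterTurn
  fun_prop

theorem quarterTurn_quarterTurn (x : Plane) : quarterTurn (quarterTurn x) = -x := by
  ext i; fin_cases i <;> simp

theorem quarterTurn_neg (x : Plane) : quarterTurn (-x) = -quarterTurn x := by
  ext i; fin_cases i <;> simp

theorem norm_quarterTurn (x : Plane) : ‖quarterTurn x‖ = ‖x‖ := by
  have : ‖quarterTurn x‖ ^ 2 = ‖x‖ ^ 2 := by
    rw [plane_norm_sq_eq, plane_norm_sq_eq]
    simp
    ring
  exact (sq_eq_sq₀ (norm_nonneg _) (norm_nonneg _)).1 this

theorem eq_zero_of_inner_eq_zero_of_inner_quarterTurn_eq_zero {x u : Plane} (hx : x ≠ 0)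
    (h : inner ℝ x u = 0) (h' : inner ℝ (quarterTurn x) u = 0) : u = 0 := by
  have key : ‖x‖ ^ 2 * ‖u‖ ^ 2 = inner ℝ x u ^ 2 + inner ℝ (quarterTurn x) u ^ 2 := by
    simp only [plane_norm_sq_eq, plane_inner_eq, quarterTurn_apply_zero, quarterTurn_apply_one]
    ring
  rw [h, h'] at key
  have hx' := norm_ne_zero_iff.2 hx
  simpa [hx'] using key

/-- `inner ℝ (quarterTurn x) y` is the determinant of `x` and `y`, so its vanishing means
parallelism; two vectors orthogonal to `u` are parallel. -/
theorem inner_quarterTurn_eq_zero_of_orthogonal {x y u : Plane} (hu : u ≠ 0)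
    (hx : inner ℝ x u = 0) (hy : inner ℝ y u = 0) : inner ℝ (quarterTurn x) y = 0 := by
  have key : ‖u‖ ^ 2 * inner ℝ (quarterTurn x) y =
      inner ℝ x u * inner ℝ (quarterTurn u) y - inner ℝ y u * inner ℝ (quarterTurn u) x := by
    simp only [plane_norm_sq_eq, plane_inner_eq, quarterTurn_apply_zero, quarterTurn_apply_one]
    ring
  rw [hx, hy] at key
  have hu' := norm_ne_zero_iff.2 hu
  simpa [hu'] using key

theorem inner_lt_of_mem_convexHull {S : Set Plane} {p v : Plane}
    (h : ∀ q ∈ S, q ≠ p → inner ℝ q v < inner ℝ p v) :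
    ∀ z ∈ convexHull ℝ S, z ≠ p → inner ℝ z v < inner ℝ p v := by
  have hconv : Convex ℝ {z : Plane | z ≠ p → inner ℝ z v < inner ℝ p v} := by
    intro x hx y hy a b ha hb hab hne
    have hle : ∀ z : Plane, (z ≠ p → inner ℝ z v < inner ℝ p v) → inner ℝ z v ≤ inner ℝ p v := by
      intro z hz
      by_cases hzp : z = p
      · rw [hzp]
      · exact (hz hzp).le
    have hx1 := hle x hx
    have hy1 := hle y hy
    obtain rfl : a = 1 - b := by linarith
    simp only [inner_add_left, inner_smul_left, conj_trivial]
    rcases eq_or_lt_of_le ha with ha0 | ha0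
    · obtain rfl : b = 1 := by linarith
      simp at hne ⊢
      exact hy hne
    rcases eq_or_lt_of_le hb with rfl | hb0
    · simp at hne ⊢
      exact hx hne
    by_cases hxp : x = p
    · by_cases hyp : y = p
      · exact absurd (by rw [hxp, hyp, ← add_smul]; simp) hne
      · have := hy hyp
        nlinarith
    · have := hx hxp
      nlinarith
  exact convexHull_min h hconv

/-- The convex hull of a nonempty finite set of points, as a convex body. -/
noncomputable def finsetBody (s : Finset Plane) (hs : s.Nonempty) : ConvexBody Plane where
  carrier := convexHull ℝ (s : Set Plane)
  convex' := convex_convexHull ℝ _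
  isCompact' := s.finite_toSet.isCompact_convexHull ℝ
  nonempty' := hs.to_set.convexHull

/-- The points of a finite set which are farthest in direction `u`. -/
def vertexFace (s : Finset Plane) (u : Plane) : Set Plane :=
  {a | a ∈ s ∧ ∀ b ∈ s, inner ℝ b u ≤ inner ℝ a u}

/-- The midpoints of the antipodal pairs of vertices with normal vectors `u` and `-u`. -/
noncomputable def vertexMidpoints (s : Finset Plane) (u : Plane) : Set Plane :=
  (1 / 2 : ℝ) • (vertexFace s u + vertexFace s (-u))

theorem mem_vertexMidpoints {s : Finset Plane} {u z : Plane} :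
    z ∈ vertexMidpoints s u ↔
      ∃ a ∈ vertexFace s u, ∃ b ∈ vertexFace s (-u), (1 / 2 : ℝ) • (a + b) = z := by
  simp only [vertexMidpoints, mem_smul_set, Set.mem_add]
  constructor
  · rintro ⟨_, ⟨x, hx, y, hy, rfl⟩, rfl⟩
    exact ⟨x, hx, y, hy, rfl⟩
  · rintro ⟨x, hx, y, hy, rfl⟩
    exact ⟨_, ⟨x, hx, y, hy, rfl⟩, rfl⟩

theorem supportFace_finsetBody (s : Finset Plane) (hs : s.Nonempty) (u : Plane) :
    supportFace (finsetBody s hs) u = convexHull ℝ (vertexFace s u) := by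
  apply Subset.antisymm
  · intro x hx
    obtain ⟨hxs, hmax⟩ := mem_supportFace.1 hx
    obtain ⟨w, hw0, hw1, hwx⟩ := Finset.mem_convexHull'.1
      (show x ∈ convexHull ℝ (s : Set Plane) from hxs)
    have hle : ∀ a ∈ s, inner ℝ a u ≤ inner ℝ x u := fun a ha =>
      hmax a (subset_convexHull ℝ (s : Set Plane) ha)
    have hsum : ∑ a ∈ s, w a * (inner ℝ x u - inner ℝ a u) = 0 := by
      have : inner ℝ x u = ∑ a ∈ s, w a * inner ℝ a u := by
        conv_lhs => rw [← hwx, sum_inner]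
        simp [inner_smul_left]
      simp only [mul_sub, Finset.sum_sub_distrib, ← Finset.sum_mul, hw1, one_mul]
      linarith
    have hterm := (Finset.sum_eq_zero_iff_of_nonneg fun a ha =>
      mul_nonneg (hw0 a ha) (sub_nonneg.2 (hle a ha))).1 hsum
    rw [← hwx]
    have hsmul : ∀ a ∈ s, w a ≠ 0 → a ∈ vertexFace s u := by
      intro a ha hwa
      have h1 := (mul_eq_zero.1 (hterm a ha)).resolve_left hwa
      exact ⟨ha, fun b hb => by linarith [hle b hb]⟩
    classical
    have h1 : ∑ a ∈ s with w a ≠ 0, w a = 1 := by rw [Finset.sum_filter_ne_zero, hw1]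
    have h2 : ∑ a ∈ s with w a ≠ 0, w a • a = ∑ a ∈ s, w a • a := by
      apply Finset.sum_filter_of_ne
      rintro a - ha hwa
      simp [hwa] at ha
    rw [← h2]
    refine (convex_convexHull ℝ _).sum_mem (fun a ha => hw0 a (Finset.mem_filter.1 ha).1) h1
      fun a ha => subset_convexHull ℝ _ ?_
    obtain ⟨ha, hwa⟩ := Finset.mem_filter.1 ha
    exact hsmul a ha hwa
  · have hmem : ∀ a ∈ vertexFace s u, a ∈ supportFace (finsetBody s hs) u := by
      rintro a ⟨ha, hmax⟩
      refine mem_supportFace.2 ⟨subset_convexHull ℝ (s : Set Plane) ha, ?_⟩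
      have hconv : Convex ℝ {y : Plane | inner ℝ y u ≤ inner ℝ a u} := by
        intro x hx y hy α β hα hβ hαβ
        simp only [mem_ofPred_eq, inner_add_left, inner_smul_left, conj_trivial] at *
        obtain rfl : α = 1 - β := by linarith
        nlinarith
      exact convexHull_min hmax hconv
    refine convexHull_min hmem ?_
    intro x hx y hy a b ha hb hab
    rw [mem_supportFace] at *
    refine ⟨(finsetBody s hs).convex hx.1 hy.1 ha hb hab, fun c hc => ?_⟩
    simp only [inner_add_left, inner_smul_left, conj_trivial]
    have h1 := hx.2 c hc
    have h2 := hy.2 c hc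
    obtain rfl : a = 1 - b := by linarith
    nlinarith

theorem middleSet_finsetBody (s : Finset Plane) (hs : s.Nonempty) (u : Plane) :
    middleSet (finsetBody s hs) u = convexHull ℝ (vertexMidpoints s u) := by
  rw [middleSet, vertexMidpoints, supportFace_finsetBody, supportFace_finsetBody, convexHull_smul,
    convexHull_add]

theorem middleSet_finsetBody_eq_singleton {s : Finset Plane} (hs : s.Nonempty) {u p : Plane}
    (h : vertexMidpoints s u ⊆ {p}) : middleSet (finsetBody s hs) u = {p} := by
  refine (middleSet_nonempty _ u).subset_singleton_iff.1 ?_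
  rw [middleSet_finsetBody]
  exact convexHull_min h (convex_singleton p)

theorem vertexFace_eq_singleton {s : Finset Plane} {a u : Plane} (ha : a ∈ s)
    (h : ∀ c ∈ s, c ≠ a → inner ℝ c u < inner ℝ a u) : vertexFace s u = {a} := by
  ext c
  constructor
  · rintro ⟨hc, hmax⟩
    by_contra hne
    exact absurd (hmax a ha) (not_le.2 (h c hc hne))
  · rintro rfl
    refine ⟨ha, fun b hb => ?_⟩
    by_cases hbc : b = c
    · rw [hbc]
    · exact (h b hb hbc).le

theorem vertexFace_nonempty {s : Finset Plane} (hs : s.Nonempty) (u : Plane) :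
    (vertexFace s u).Nonempty := by
  obtain ⟨a, ha, h⟩ := s.exists_max_image (fun b => inner ℝ b u) hs
  exact ⟨a, ha, h⟩

theorem vertexMidpoints_nonempty {s : Finset Plane} (hs : s.Nonempty) (u : Plane) :
    (vertexMidpoints s u).Nonempty := by
  obtain ⟨a, ha⟩ := vertexFace_nonempty hs u
  obtain ⟨b, hb⟩ := vertexFace_nonempty hs (-u)
  exact ⟨_, mem_vertexMidpoints.2 ⟨a, ha, b, hb, rfl⟩⟩

theorem finite_iUnion_vertexMidpoints (s : Finset Plane) :
    {z | ∃ u : Plane, u ≠ 0 ∧ z ∈ vertexMidpoints s u}.Finite := by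
  refine ((s.finite_toSet.prod s.finite_toSet).image
    fun q : Plane × Plane => (1 / 2 : ℝ) • (q.1 + q.2)).subset ?_
  rintro z ⟨u, -, hz⟩
  obtain ⟨a, ha, b, hb, rfl⟩ := mem_vertexMidpoints.1 hz
  exact ⟨(a, b), ⟨ha.1, hb.1⟩, rfl⟩

theorem eventually_forall_inner_lt {S : Set Plane} (hS : S.Finite) {p v : Plane}
    (h : ∀ q ∈ S, q ≠ p → inner ℝ q v < inner ℝ p v) :
    ∀ᶠ w in 𝓝 v, ∀ q ∈ S, q ≠ p → inner ℝ q w < inner ℝ p w := by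
  rw [hS.eventually_all]
  intro q hq
  by_cases hqp : q = p
  · simp [hqp]
  · have := (isOpen_lt (f := fun w : Plane => inner ℝ q w) (g := fun w : Plane => inner ℝ p w)
      (by fun_prop) (by fun_prop)).mem_nhds (h q hq hqp)
    filter_upwards [this] with w hw _ using hw

/-- A lexicographic maximum for `u`, then `d`, is the unique maximum for `u` tilted slightly towards
`d`. -/
theorem eventually_forall_inner_add_smul_lt (s : Finset Plane) {a u d : Plane}
    (h : ∀ c ∈ s, c ≠ a → inner ℝ c u < inner ℝ a u ∨
      inner ℝ c u ≤ inner ℝ a u ∧ inner ℝ c d < inner ℝ a d) :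
    ∀ᶠ t in 𝓝[>] (0 : ℝ), ∀ c ∈ s, c ≠ a → inner ℝ c (u + t • d) < inner ℝ a (u + t • d) := by
  rw [Finset.eventually_all]
  intro c hc
  by_cases hca : c = a
  · simp [hca]
  rcases h c hc hca with hlt | ⟨hle, hlt⟩
  · have : {t : ℝ | inner ℝ c (u + t • d) < inner ℝ a (u + t • d)} ∈ 𝓝 (0 : ℝ) :=
      (isOpen_lt (by fun_prop) (by fun_prop)).mem_nhds (by simpa using hlt)
    filter_upwards [nhdsWithin_le_nhds this] with t ht _ using ht
  · filter_upwards [self_mem_nhdsWithin] with t ht _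
    have ht' : 0 < t := ht
    simp only [inner_add_right, inner_smul_right]
    have := mul_lt_mul_of_pos_left hlt ht'
    linarith

end Polygons

/-! ### Polygons without parallel edges, and an exposed midpoint that is stable in the normal. -/

section GenericPolygons

open Set Metric Filter Topology

theorem vertexMidpoints_neg (s : Finset Plane) (u : Plane) :
    vertexMidpoints s (-u) = vertexMidpoints s u := by
  rw [vertexMidpoints, vertexMidpoints, neg_neg, add_comm]

theorem eventually_vertexMidpoints_eq {s : Finset Plane} {a b u : Plane} (ha : a ∈ s) (hb : b ∈ s)
    (hau : ∀ c ∈ s, c ≠ a → inner ℝ c u < inner ℝ a u)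
    (hbu : ∀ c ∈ s, c ≠ b → inner ℝ c (-u) < inner ℝ b (-u)) :
    ∀ᶠ w in 𝓝 u, vertexMidpoints s w = {(1 / 2 : ℝ) • (a + b)} := by
  have h1 := eventually_forall_inner_lt s.finite_toSet hau
  have h2 := (continuous_neg.tendsto u).eventually (eventually_forall_inner_lt s.finite_toSet hbu)
  filter_upwards [h1, h2] with w hw1 hw2
  rw [vertexMidpoints, vertexFace_eq_singleton ha hw1, vertexFace_eq_singleton hb hw2]
  simp

/-- When one of the two opposite faces is a single vertex, comparing midpoints in direction `v`
amounts to comparing vertices of the other face. Tilting `u` towards `v` then isolates the pair with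
midpoint `p`. -/
theorem exists_eventually_vertexMidpoints_eq {s : Finset Plane} {p v u : Plane}
    (hu : u ≠ 0) (hs : (vertexFace s u).Subsingleton ∨ (vertexFace s (-u)).Subsingleton)
    (hp : p ∈ vertexMidpoints s u)
    (hv : ∀ q ∈ vertexMidpoints s u, q ≠ p → inner ℝ q v < inner ℝ p v) :
    ∃ w : Plane, w ≠ 0 ∧ ∀ᶠ w' in 𝓝 w, vertexMidpoints s w' = {p} := by
  wlog h : (vertexFace s (-u)).Subsingleton generalizing u
  · refine this (u := -u) (neg_ne_zero.2 hu) ?_ ?_ ?_ ?_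
    · rw [neg_neg]; exact hs.symm
    · rwa [vertexMidpoints_neg]
    · rwa [vertexMidpoints_neg]
    · rw [neg_neg]
      exact hs.resolve_right h
  obtain ⟨a, ha, b, hb, rfl⟩ := mem_vertexMidpoints.1 hp
  have h1 : ∀ c ∈ s, c ≠ a → inner ℝ c u < inner ℝ a u ∨
      inner ℝ c u ≤ inner ℝ a u ∧ inner ℝ c v < inner ℝ a v := by
    intro c hc hca
    rcases lt_or_eq_of_le (ha.2 c hc) with hlt | heq
    · exact Or.inl hlt
    · refine Or.inr ⟨heq.le, ?_⟩
      have hcu : c ∈ vertexFace s u := ⟨hc, fun d hd => heq ▸ ha.2 d hd⟩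
      have := hv _ (mem_vertexMidpoints.2 ⟨c, hcu, b, hb, rfl⟩) (by simpa using hca)
      simp only [inner_smul_left, inner_add_left, conj_trivial] at this
      linarith
  have h2 : ∀ c ∈ s, c ≠ b → inner ℝ c (-u) < inner ℝ b (-u) ∨
      inner ℝ c (-u) ≤ inner ℝ b (-u) ∧ inner ℝ c (-v) < inner ℝ b (-v) := by
    intro c hc hcb
    refine Or.inl (lt_of_le_of_ne (hb.2 c hc) fun heq => hcb ?_)
    exact h ⟨hc, fun d hd => heq ▸ hb.2 d hd⟩ hb
  have h3 : ∀ᶠ t in 𝓝[>] (0 : ℝ), u + t • v ≠ 0 := by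
    refine nhdsWithin_le_nhds ?_
    have : Tendsto (fun t : ℝ => u + t • v) (𝓝 0) (𝓝 (u + (0 : ℝ) • v)) :=
      Continuous.tendsto (by fun_prop) 0
    rw [zero_smul, add_zero] at this
    exact this.eventually_ne hu
  obtain ⟨t, ht1, ht2, ht3⟩ := ((eventually_forall_inner_add_smul_lt s h1).and
    ((eventually_forall_inner_add_smul_lt s h2).and h3)).exists
  refine ⟨u + t • v, ht3, eventually_vertexMidpoints_eq ha.1 hb.1 ht1 ?_⟩
  rwa [neg_add, ← smul_neg]

theorem exists_exposed_vertexMidpoint {s : Finset Plane} (hs : s.Nonempty)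
    (hgen : ∀ u : Plane, u ≠ 0 → (vertexFace s u).Subsingleton ∨ (vertexFace s (-u)).Subsingleton)
    {ρ : ℝ} (hρ : 0 < ρ) :
    ∃ p v w : Plane, ‖w‖ < ρ ∧ inner ℝ (quarterTurn w) v < 0 ∧
      (∀ᶠ v' in 𝓝 v, ∀ z ∈ middleHedgehog (finsetBody s hs), z ≠ p →
        inner ℝ z v' < inner ℝ p v') ∧
      ∀ᶠ w' in 𝓝 w, middleSet (finsetBody s hs) w' = {p} := by
  set S := {z | ∃ u : Plane, u ≠ 0 ∧ z ∈ vertexMidpoints s u} with hS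
  have hfin : S.Finite := finite_iUnion_vertexMidpoints s
  have hne : S.Nonempty := by
    obtain ⟨u, hu⟩ := exists_ne (0 : Plane)
    obtain ⟨z, hz⟩ := vertexMidpoints_nonempty hs u
    exact ⟨z, u, hu, hz⟩
  -- A vertex midpoint of largest norm is exposed in its own direction.
  obtain ⟨p, hpS, hmax⟩ := hfin.exists_maximalFor (fun z : Plane => ‖z‖) S hne
  have hnorm : ∀ q ∈ S, ‖q‖ ≤ ‖p‖ := fun q hq => by
    by_contra! hlt
    exact absurd (hmax hq hlt.le) (not_le.2 hlt)
  have hp : ∀ q ∈ S, q ≠ p → inner ℝ q p < inner ℝ p p := by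
    intro q hq hqp
    have h1 : 0 < ‖q - p‖ := norm_pos_iff.2 (sub_ne_zero.2 hqp)
    have h2 := norm_sub_sq_real q p
    have h3 := hnorm q hq
    have h4 : ‖q‖ ^ 2 ≤ ‖p‖ ^ 2 := by gcongr
    rw [real_inner_self_eq_norm_sq]
    nlinarith [pow_pos h1 2]
  obtain ⟨u, hu, hpu⟩ := hpS
  obtain ⟨w₀, hw₀, hev⟩ := exists_eventually_vertexMidpoints_eq hu (hgen u hu) hpu
    (v := p) fun q hq => hp q ⟨u, hu, hq⟩
  have hvert := eventually_forall_inner_lt hfin hp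
  -- The exposing direction can be moved slightly, so it may be assumed not parallel to `w₀`. The
  -- sign of the product is then fixed by passing to `-w₀`, which has the same middle set.
  obtain ⟨v, hv, hwv⟩ : ∃ v : Plane, (∀ᶠ v' in 𝓝 v, ∀ q ∈ S, q ≠ p →
      inner ℝ q v' < inner ℝ p v') ∧ inner ℝ (quarterTurn w₀) v ≠ 0 := by
    by_cases h0 : inner ℝ (quarterTurn w₀) p = 0
    · have ht : Tendsto (fun t : ℝ => p + t • quarterTurn w₀) (𝓝[>] 0) (𝓝 p) := by
        have : Tendsto (fun t : ℝ => p + t • quarterTurn w₀) (𝓝 0)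
            (𝓝 (p + (0 : ℝ) • quarterTurn w₀)) := Continuous.tendsto (by fun_prop) 0
        rw [zero_smul, add_zero] at this
        exact this.mono_left nhdsWithin_le_nhds
      obtain ⟨t, ht1, ht0⟩ := ((ht.eventually hvert.eventually_nhds).and
        self_mem_nhdsWithin).exists
      refine ⟨_, ht1, ?_⟩
      rw [inner_add_right, h0, zero_add, inner_smul_right, real_inner_self_eq_norm_sq,
        norm_quarterTurn]
      have : 0 < t := ht0
      have := norm_pos_iff.2 hw₀
      positivity
    · exact ⟨p, hvert, h0⟩
  have hmid : ∀ᶠ w' in 𝓝 w₀, middleSet (finsetBody s hs) w' = {p} := by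
    filter_upwards [hev] with w' hw'
    exact middleSet_finsetBody_eq_singleton hs hw'.subset
  have hscale : ∀ c : ℝ, 0 < c →
      ∀ᶠ w' in 𝓝 (c • w₀), middleSet (finsetBody s hs) w' = {p} := by
    intro c hc
    have ht : Tendsto (fun w' : Plane => c⁻¹ • w') (𝓝 (c • w₀)) (𝓝 w₀) := by
      have := (continuous_const_smul c⁻¹ (T := Plane)).tendsto (c • w₀)
      rwa [smul_smul, inv_mul_cancel₀ hc.ne', one_smul] at this
    filter_upwards [ht.eventually hmid] with w' hw'
    rwa [middleSet_smul _ _ (inv_pos.2 hc)] at hw'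
  have hneg : ∀ u : Plane, middleSet (finsetBody s hs) (-u) = middleSet (finsetBody s hs) u := by
    intro u
    rw [middleSet_finsetBody, middleSet_finsetBody, vertexMidpoints_neg]
  set c := ρ / 2 / ‖w₀‖ with hc
  have hw₀' := norm_pos_iff.2 hw₀
  have hc0 : 0 < c := by positivity
  have hcn : ‖c • w₀‖ < ρ := by
    rw [norm_smul, Real.norm_of_nonneg hc0.le, hc]
    field_simp
    linarith
  have hquarter : inner ℝ (quarterTurn (c • w₀)) v = c * inner ℝ (quarterTurn w₀) v := by
    simp [plane_inner_eq]; ring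
  have hv' : ∀ᶠ v' in 𝓝 v, ∀ z ∈ middleHedgehog (finsetBody s hs), z ≠ p →
      inner ℝ z v' < inner ℝ p v' := by
    filter_upwards [hv] with v' hv' z hz
    obtain ⟨u, hu, hz⟩ := mem_middleHedgehog.1 hz
    rw [middleSet_finsetBody] at hz
    exact inner_lt_of_mem_convexHull
      (fun q hq => hv' q ⟨u, norm_ne_zero_iff.1 (hu ▸ one_ne_zero), hq⟩) z hz
  rcases lt_or_gt_of_ne hwv with hlt | hgt
  · refine ⟨p, v, c • w₀, hcn, ?_, hv', hscale c hc0⟩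
    rw [hquarter]
    exact mul_neg_of_pos_of_neg hc0 hlt
  · refine ⟨p, v, -(c • w₀), by rwa [norm_neg], ?_, hv', ?_⟩
    · rw [quarterTurn_neg, inner_neg_left, hquarter]
      exact neg_neg_of_pos (mul_pos hc0 hgt)
    · have ht : Tendsto (fun w' : Plane => -w') (𝓝 (-(c • w₀))) (𝓝 (c • w₀)) := by
        simpa using (continuous_neg (G := Plane)).tendsto (-(c • w₀))
      filter_upwards [ht.eventually (hscale c hc0)] with w' hw'
      rwa [hneg] at hw'

theorem eventually_quadratic_ne_zero (A B : ℝ) {C : ℝ} (hC : C ≠ 0) :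
    ∀ᶠ t in 𝓝[>] (0 : ℝ), A + B * t + C * t ^ 2 ≠ 0 := by
  open Polynomial in
  set q : Polynomial ℝ := Polynomial.C A + Polynomial.C B * X + Polynomial.C C * X ^ 2 with hq
  have hq0 : q ≠ 0 := by
    intro h
    have := congrArg (fun r => Polynomial.coeff r 2) h
    simp [hq] at this
    exact hC this
  have hfin : ({x | q.IsRoot x} \ {0}).Finite := (Polynomial.finite_setOfPred_isRoot hq0).sdiff
  -- The root `0` is discarded because `A` may vanish; only `t > 0` matters.
  have h0 : (0 : ℝ) ∈ ({x | q.IsRoot x} \ {0})ᶜ := fun h => h.2 rfl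
  filter_upwards [nhdsWithin_le_nhds (hfin.isClosed.isOpen_compl.mem_nhds h0),
    self_mem_nhdsWithin] with t ht ht0 hroot
  have ht0' : 0 < t := ht0
  refine ht ⟨?_, ht0'.ne'⟩
  simpa [hq, Polynomial.IsRoot] using hroot

theorem two_pow_add_two_pow_injective {i j k l : ℕ} (hij : i ≠ j) (hkl : k ≠ l)
    (h : 2 ^ i + 2 ^ j = 2 ^ k + 2 ^ l) : ({i, j} : Finset ℕ) = {k, l} := by
  apply Finset.geomSum_injective le_rfl
  simpa [Finset.sum_pair hij, Finset.sum_pair hkl] using h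

/-- Each determinant is a quadratic polynomial in the perturbation parameter, so it is nonzero for
small `t > 0` once its leading coefficient is nonzero. -/
theorem exists_generic_perturbation (x : ℕ → Plane) (n : ℕ) {ε : ℝ} (hε : 0 < ε) :
    ∃ y : ℕ → Plane, (∀ i < n, dist (y i) (x i) < ε) ∧
      ∀ i < n, ∀ j < n, ∀ k < n, ∀ l < n, i ≠ j → k ≠ l →
        inner ℝ (quarterTurn (y i - y j)) (y k - y l) = 0 → ({i, j} : Finset ℕ) = {k, l} := by
  -- These points lie on the parabola `y = x ^ 2`, where the chord through `i` and `j` has slope `2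
  -- ^ i + 2 ^ j`. By uniqueness of binary expansions, different pairs have different slopes.
  set d : ℕ → Plane := fun i => !₂[2 ^ i, 4 ^ i] with hd
  have h1 : ∀ i < n, ∀ᶠ t in 𝓝[>] (0 : ℝ), dist (x i + t • d i) (x i) < ε := by
    intro i _
    have : Tendsto (fun t : ℝ => x i + t • d i) (𝓝 0) (𝓝 (x i + (0 : ℝ) • d i)) :=
      Continuous.tendsto (by fun_prop) 0
    rw [zero_smul, add_zero] at this
    exact nhdsWithin_le_nhds (this.eventually (ball_mem_nhds _ hε))
  have h2 : ∀ i < n, ∀ j < n, ∀ k < n, ∀ l < n, ∀ᶠ t in 𝓝[>] (0 : ℝ), i ≠ j → k ≠ l →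
      inner ℝ (quarterTurn ((x i + t • d i) - (x j + t • d j)))
        ((x k + t • d k) - (x l + t • d l)) = 0 → ({i, j} : Finset ℕ) = {k, l} := by
    intro i _ j _ k _ l _
    by_cases hij : i = j
    · simp [hij]
    by_cases hkl : k = l
    · simp [hkl]
    by_cases hpair : ({i, j} : Finset ℕ) = {k, l}
    · simp [hpair]
    have hC : inner ℝ (quarterTurn (d i - d j)) (d k - d l) ≠ 0 := by
      have hfac : inner ℝ (quarterTurn (d i - d j)) (d k - d l) =
          ((2 : ℝ) ^ i - 2 ^ j) * (2 ^ k - 2 ^ l) * ((2 ^ k + 2 ^ l) - (2 ^ i + 2 ^ j)) := by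
        have h4 : ∀ m : ℕ, (4 : ℝ) ^ m = 2 ^ m * 2 ^ m := fun m => by rw [← mul_pow]; norm_num
        simp [plane_inner_eq, hd, h4]
        ring
      have hinj : ∀ a b : ℕ, a ≠ b → (2 : ℝ) ^ a - 2 ^ b ≠ 0 := fun a b hab =>
        sub_ne_zero.2 fun h => hab (pow_right_injective₀ (by norm_num) (by norm_num) h)
      rw [hfac]
      refine mul_ne_zero (mul_ne_zero (hinj _ _ hij) (hinj _ _ hkl)) (sub_ne_zero.2 fun h => ?_)
      exact hpair (two_pow_add_two_pow_injective hij hkl (by exact_mod_cast h.symm))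
    filter_upwards [eventually_quadratic_ne_zero (inner ℝ (quarterTurn (x i - x j)) (x k - x l))
      (inner ℝ (quarterTurn (x i - x j)) (d k - d l) +
        inner ℝ (quarterTurn (d i - d j)) (x k - x l)) hC] with t ht _ _ h0
    refine absurd ?_ ht
    rw [← h0]
    simp [plane_inner_eq]
    ring
  have h1' := (Finset.eventually_all (Finset.range n)).2 fun i hi => h1 i (Finset.mem_range.1 hi)
  have h2' := (Finset.eventually_all (Finset.range n)).2 fun i hi =>
    (Finset.eventually_all (Finset.range n)).2 fun j hj =>
    (Finset.eventually_all (Finset.range n)).2 fun k hk =>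
    (Finset.eventually_all (Finset.range n)).2 fun l hl =>
      h2 i (Finset.mem_range.1 hi) j (Finset.mem_range.1 hj) k (Finset.mem_range.1 hk) l
        (Finset.mem_range.1 hl)
  simp only [Finset.mem_range] at h1' h2'
  obtain ⟨t, ht1, ht2⟩ := (h1'.and h2').exists
  exact ⟨fun i => x i + t • d i, ht1, ht2⟩

/-- Two nondegenerate opposite faces give parallel chords, hence the same pair of indices. All
points then lie on one line, and a third point yields a forbidden parallel pair. -/
theorem vertexFace_subsingleton_or {n : ℕ} (hn : 3 ≤ n) {y : ℕ → Plane}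
    (hy : ∀ i < n, ∀ j < n, ∀ k < n, ∀ l < n, i ≠ j → k ≠ l →
        inner ℝ (quarterTurn (y i - y j)) (y k - y l) = 0 → ({i, j} : Finset ℕ) = {k, l})
    {s : Finset Plane} (hs : ∀ a, a ∈ s ↔ ∃ i < n, y i = a) {u : Plane} (hu : u ≠ 0) :
    (vertexFace s u).Subsingleton ∨ (vertexFace s (-u)).Subsingleton := by
  by_contra! hcon
  obtain ⟨⟨a, ha, a', ha', haa⟩, ⟨b, hb, b', hb', hbb⟩⟩ := hcon
  obtain ⟨i, hi, rfl⟩ := (hs a).1 ha.1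
  obtain ⟨j, hj, rfl⟩ := (hs a').1 ha'.1
  obtain ⟨k, hk, rfl⟩ := (hs b).1 hb.1
  obtain ⟨l, hl, rfl⟩ := (hs b').1 hb'.1
  have hij : i ≠ j := fun h => haa (h ▸ rfl)
  have hkl : k ≠ l := fun h => hbb (h ▸ rfl)
  have hau : inner ℝ (y i - y j) u = 0 := by
    rw [inner_sub_left, sub_eq_zero]
    exact le_antisymm (ha'.2 _ ha.1) (ha.2 _ ha'.1)
  have hbu : inner ℝ (y k - y l) u = 0 := by
    have h1 := hb'.2 _ hb.1
    have h2 := hb.2 _ hb'.1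
    rw [inner_neg_right, inner_neg_right] at h1 h2
    rw [inner_sub_left]
    linarith
  have hpair := hy i hi j hj k hk l hl hij hkl
    (inner_quarterTurn_eq_zero_of_orthogonal hu hau hbu)
  have hmin : ∀ m < n, inner ℝ (y i) u ≤ inner ℝ (y m) u := by
    intro m hm
    have hik : i = k ∨ i = l := by
      have : i ∈ ({k, l} : Finset ℕ) := hpair ▸ Finset.mem_insert_self i _
      simpa using this
    have h1 := hb.2 (y m) ((hs _).2 ⟨m, hm, rfl⟩)
    have h2 := hb'.2 (y m) ((hs _).2 ⟨m, hm, rfl⟩)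
    simp only [inner_neg_right, neg_le_neg_iff] at h1 h2
    rcases hik with rfl | rfl
    exacts [h1, h2]
  obtain ⟨m, hm, hmi, hmj⟩ : ∃ m < n, m ≠ i ∧ m ≠ j := by
    by_contra! h
    have h0 := h 0 (by omega)
    have h1 := h 1 (by omega)
    have h2 := h 2 (by omega)
    omega
  have hmu : inner ℝ (y i - y m) u = 0 := by
    rw [inner_sub_left, sub_eq_zero]
    exact le_antisymm (hmin m hm) (ha.2 _ ((hs _).2 ⟨m, hm, rfl⟩))
  have hpair' := hy i hi j hj i hi m hm hij hmi.symm
    (inner_quarterTurn_eq_zero_of_orthogonal hu hau hmu)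
  have : m ∈ ({i, j} : Finset ℕ) := hpair' ▸ by simp
  simp [hmi, hmj] at this

theorem exists_generic_polygon_dist_lt (K : ConvexBody Plane) {ε : ℝ} (hε : 0 < ε) :
    ∃ (s : Finset Plane) (hs : s.Nonempty), dist (finsetBody s hs) K < ε ∧
      ∀ u : Plane, u ≠ 0 → (vertexFace s u).Subsingleton ∨ (vertexFace s (-u)).Subsingleton := by
  classical
  obtain ⟨t, htK, htfin, hcover⟩ := finite_cover_balls_of_compact K.isCompact
    (e := ε / 4) (by positivity)
  obtain ⟨x₀, hx₀⟩ := K.nonempty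
  set m := htfin.toFinset.card
  set e := htfin.toFinset.equivFin
  set x : ℕ → Plane := fun i => if h : i < m then (e.symm ⟨i, h⟩ : Plane) else x₀ with hx
  have hxK : ∀ i, x i ∈ K := by
    intro i
    by_cases h : i < m
    · simp only [hx, h, dif_pos]
      exact htK (htfin.mem_toFinset.1 (e.symm ⟨i, h⟩).2)
    · simp only [hx, h, dif_neg, not_false_eq_true]
      exact hx₀
  have hxt : ∀ a ∈ t, ∃ i < m + 3, x i = a := by
    intro a ha
    refine ⟨e ⟨a, htfin.mem_toFinset.2 ha⟩, by omega, ?_⟩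
    simp [hx, m, e]
  -- The net is padded with copies of `x₀` to guarantee at least three points.
  obtain ⟨y, hyx, hy⟩ := exists_generic_perturbation x (m + 3) (ε := ε / 4) (by positivity)
  set s : Finset Plane := (Finset.range (m + 3)).image y with hs
  have hmem : ∀ a, a ∈ s ↔ ∃ i < m + 3, y i = a := by simp [hs]
  have hsne : s.Nonempty := ⟨y 0, (hmem _).2 ⟨0, by omega, rfl⟩⟩
  refine ⟨s, hsne, ?_, fun u hu => vertexFace_subsingleton_or (by omega) hy hmem hu⟩
  refine lt_of_le_of_lt (hausdorffDist_le_of_mem_dist (r := ε / 2) (by positivity) ?_ ?_)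
    (half_lt_self hε)
  · have hsub : convexHull ℝ (s : Set Plane) ⊆ cthickening (ε / 4) (K : Set Plane) := by
      refine convexHull_min ?_ (K.convex.cthickening _)
      intro a ha
      obtain ⟨i, hi, rfl⟩ := (hmem a).1 ha
      exact mem_cthickening_of_dist_le _ _ _ _ (hxK i) (hyx i hi).le
    intro z hz
    have hz' := hsub hz
    rw [K.isCompact.cthickening_eq_biUnion_closedBall (by positivity)] at hz'
    simp only [mem_iUnion, mem_closedBall] at hz'
    obtain ⟨b, hb, hzb⟩ := hz'
    exact ⟨b, hb, by linarith⟩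
  · intro z hz
    have hz' := hcover hz
    simp only [mem_iUnion, mem_ball] at hz'
    obtain ⟨a, ha, hza⟩ := hz'
    obtain ⟨i, hi, rfl⟩ := hxt a ha
    refine ⟨y i, subset_convexHull ℝ (s : Set Plane) ((hmem _).2 ⟨i, hi, rfl⟩), ?_⟩
    have h1 := dist_triangle_right z (y i) (x i)
    have h2 := hyx i hi
    linarith

end GenericPolygons

/-! ### Thin triangles, whose middle set is `{0}` except for a narrow range of normals. -/

section Triangles

open Set Metric Filter Topology

open Classical in
/-- The vertices of a thin triangle; one of its three antipodal midpoints is `0`, another is `z`. -/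
noncomputable def triangleVertices (z : Plane) (τ : ℝ) : Finset Plane :=
  {(2 : ℝ) • z + τ • quarterTurn z, -((2 : ℝ) • z + τ • quarterTurn z), -(τ • quarterTurn z)}

theorem mem_triangleVertices {z : Plane} {τ : ℝ} {a : Plane} : a ∈ triangleVertices z τ ↔
    a = (2 : ℝ) • z + τ • quarterTurn z ∨ a = -((2 : ℝ) • z + τ • quarterTurn z) ∨
      a = -(τ • quarterTurn z) := by
  simp [triangleVertices]

theorem triangleVertices_nonempty (z : Plane) (τ : ℝ) : (triangleVertices z τ).Nonempty :=
  ⟨_, mem_triangleVertices.2 (Or.inl rfl)⟩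

/-- The thin triangle with vertices `triangleVertices z τ`. -/
noncomputable def thinTriangle (z : Plane) (τ : ℝ) : ConvexBody Plane :=
  finsetBody (triangleVertices z τ) (triangleVertices_nonempty z τ)

theorem norm_le_of_mem_thinTriangle {z : Plane} {τ : ℝ} (h0 : 0 ≤ τ) (h1 : τ ≤ 1) :
    ∀ x ∈ thinTriangle z τ, ‖x‖ ≤ 3 * ‖z‖ := by
  have hτ : ‖τ • quarterTurn z‖ ≤ ‖z‖ := by
    rw [norm_smul, norm_quarterTurn, Real.norm_of_nonneg h0]
    exact mul_le_of_le_one_left (norm_nonneg z) h1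
  have h2 : ‖(2 : ℝ) • z + τ • quarterTurn z‖ ≤ 3 * ‖z‖ := by
    refine (norm_add_le _ _).trans ?_
    rw [norm_smul, Real.norm_ofNat]
    linarith
  have hsub : convexHull ℝ (triangleVertices z τ : Set Plane) ⊆ closedBall 0 (3 * ‖z‖) := by
    refine convexHull_min ?_ (convex_closedBall _ _)
    intro a ha
    rw [mem_closedBall_zero_iff]
    rcases mem_triangleVertices.1 ha with rfl | rfl | rfl
    · exact h2
    · rwa [norm_neg]
    · rw [norm_neg]
      linarith [norm_nonneg z]
  intro x hx
  simpa using hsub hx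

theorem inner_le_of_mem_vertexFace_triangleVertices {z u a : Plane} {τ : ℝ}
    (ha : a ∈ vertexFace (triangleVertices z τ) u) :
    2 * inner ℝ z u + τ * inner ℝ (quarterTurn z) u ≤ inner ℝ a u ∧
      -(2 * inner ℝ z u + τ * inner ℝ (quarterTurn z) u) ≤ inner ℝ a u ∧
      -(τ * inner ℝ (quarterTurn z) u) ≤ inner ℝ a u := by
  have h1 := ha.2 _ (mem_triangleVertices.2 (Or.inl rfl))
  have h2 := ha.2 _ (mem_triangleVertices.2 (Or.inr (Or.inl rfl)))
  have h3 := ha.2 _ (mem_triangleVertices.2 (Or.inr (Or.inr rfl)))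
  simp only [inner_add_left, inner_neg_left, inner_smul_left, conj_trivial] at h1 h2 h3
  exact ⟨h1, h2, h3⟩

theorem inner_of_mem_triangleVertices {z u a : Plane} {τ : ℝ} (ha : a ∈ triangleVertices z τ) :
    (a = (2 : ℝ) • z + τ • quarterTurn z ∧
        inner ℝ a u = 2 * inner ℝ z u + τ * inner ℝ (quarterTurn z) u) ∨
      (a = -((2 : ℝ) • z + τ • quarterTurn z) ∧
        inner ℝ a u = -(2 * inner ℝ z u + τ * inner ℝ (quarterTurn z) u)) ∨
      (a = -(τ • quarterTurn z) ∧ inner ℝ a u = -(τ * inner ℝ (quarterTurn z) u)) := by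
  rcases mem_triangleVertices.1 ha with rfl | rfl | rfl
  · exact Or.inl ⟨rfl, by simp [inner_add_left, inner_smul_left]⟩
  · exact Or.inr (Or.inl ⟨rfl, by simp [inner_add_left, inner_smul_left]⟩)
  · exact Or.inr (Or.inr ⟨rfl, by simp [inner_smul_left]⟩)

theorem vertexMidpoints_triangleVertices_subset {z u : Plane} {τ : ℝ} (hz : z ≠ 0) (hτ : 0 < τ)
    (hu : u ≠ 0) :
    vertexMidpoints (triangleVertices z τ) u ⊆ {0, z, -z - τ • quarterTurn z} := by
  intro q hq
  obtain ⟨a, ha, b, hb, rfl⟩ := mem_vertexMidpoints.1 hq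
  obtain ⟨h1, h2, h3⟩ := inner_le_of_mem_vertexFace_triangleVertices ha
  obtain ⟨h4, h5, h6⟩ := inner_le_of_mem_vertexFace_triangleVertices hb
  simp only [inner_neg_right] at h4 h5 h6
  have hab : a ≠ b := by
    rintro rfl
    have he : 2 * inner ℝ z u + τ * inner ℝ (quarterTurn z) u = 0 := by linarith
    have hc : τ * inner ℝ (quarterTurn z) u = 0 := by linarith
    have hc' := (mul_eq_zero.1 hc).resolve_left hτ.ne'
    exact hu (eq_zero_of_inner_eq_zero_of_inner_quarterTurn_eq_zero hz (by linarith) hc')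
  have e1 : (1 / 2 : ℝ) • ((2 : ℝ) • z + τ • quarterTurn z + -(τ • quarterTurn z)) = z := by
    module
  have e2 : (1 / 2 : ℝ) • (-((2 : ℝ) • z + τ • quarterTurn z) + -(τ • quarterTurn z)) =
      -z - τ • quarterTurn z := by module
  simp only [mem_insert_iff, mem_singleton_iff]
  rcases mem_triangleVertices.1 ha.1 with ha | ha | ha <;>
    rcases mem_triangleVertices.1 hb.1 with hb | hb | hb <;> subst ha <;> subst hb
  · exact absurd rfl hab
  · left; simp
  · right; left; exact e1
  · left; simp
  · exact absurd rfl hab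
  · right; right; exact e2
  · right; left; rw [add_comm, e1]
  · right; right; rw [add_comm, e2]
  · exact absurd rfl hab

/-- The hypothesis puts the third vertex strictly between the two opposite ones in direction `u`, so
these two form the only antipodal pair. -/
theorem middleSet_thinTriangle_eq_zero {z u : Plane} {τ : ℝ}
    (h : |τ * inner ℝ (quarterTurn z) u| < |2 * inner ℝ z u + τ * inner ℝ (quarterTurn z) u|) :
    middleSet (thinTriangle z τ) u = {0} := by
  apply middleSet_finsetBody_eq_singleton
  intro q hq
  obtain ⟨a, ha, b, hb, rfl⟩ := mem_vertexMidpoints.1 hq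
  obtain ⟨h1, h2, h3⟩ := inner_le_of_mem_vertexFace_triangleVertices ha
  obtain ⟨h4, h5, h6⟩ := inner_le_of_mem_vertexFace_triangleVertices hb
  simp only [inner_neg_right] at h4 h5 h6
  rw [lt_abs, abs_lt, abs_lt] at h
  rw [mem_singleton_iff]
  rcases inner_of_mem_triangleVertices (u := u) ha.1 with ⟨ha, hau⟩ | ⟨ha, hau⟩ | ⟨ha, hau⟩ <;>
    rcases inner_of_mem_triangleVertices (u := u) hb.1 with ⟨hb, hbu⟩ | ⟨hb, hbu⟩ | ⟨hb, hbu⟩ <;>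
    first
    | (exfalso; rcases h with h | h <;> linarith [h.1, h.2])
    | (rw [ha, hb]; simp)

theorem middleSet_thinTriangle_eq_self {z : Plane} {τ : ℝ} (hz : z ≠ 0) (hτ : 0 < τ) :
    -- Any coefficient strictly between `0` and `τ / 2` would do: the three vertices then have
    -- distinct heights, with `2z + τ Jz` on top and `-τ Jz` at the bottom (`J` the quarter turn).
    middleSet (thinTriangle z τ) (quarterTurn z - (τ / 4) • z) = {z} := by
  set u := quarterTurn z - (τ / 4) • z with hu
  have hN : 0 < ‖z‖ ^ 2 := pow_pos (norm_pos_iff.2 hz) 2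
  have hα : inner ℝ z u = -(τ / 4 * ‖z‖ ^ 2) := by
    simp only [hu, plane_inner_eq, plane_norm_sq_eq]
    simp
    ring
  have hβ : inner ℝ (quarterTurn z) u = ‖z‖ ^ 2 := by
    simp only [hu, plane_inner_eq, plane_norm_sq_eq]
    simp
    ring
  have hpos : 0 < τ * ‖z‖ ^ 2 := mul_pos hτ hN
  apply middleSet_finsetBody_eq_singleton
  intro q hq
  obtain ⟨a, ha, b, hb, rfl⟩ := mem_vertexMidpoints.1 hq
  obtain ⟨h1, h2, h3⟩ := inner_le_of_mem_vertexFace_triangleVertices ha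
  obtain ⟨h4, h5, h6⟩ := inner_le_of_mem_vertexFace_triangleVertices hb
  simp only [inner_neg_right, hα, hβ] at h1 h2 h3 h4 h5 h6
  have ha' := inner_of_mem_triangleVertices (u := u) ha.1
  have hb' := inner_of_mem_triangleVertices (u := u) hb.1
  simp only [hα, hβ] at ha' hb'
  rw [mem_singleton_iff]
  have hae : a = (2 : ℝ) • z + τ • quarterTurn z := by
    rcases ha' with ⟨ha, -⟩ | ⟨-, hau⟩ | ⟨-, hau⟩
    · exact ha
    · exfalso; linarith
    · exfalso; linarith
  have hbe : b = -(τ • quarterTurn z) := by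
    rcases hb' with ⟨-, hbu⟩ | ⟨-, hbu⟩ | ⟨hb, -⟩
    · exfalso; linarith
    · exfalso; linarith
    · exact hb
  rw [hae, hbe]
  module

theorem abs_inner_quarterTurn_le (x y : Plane) : |inner ℝ (quarterTurn x) y| ≤ ‖x‖ * ‖y‖ := by
  rw [← norm_quarterTurn x]
  exact abs_real_inner_le_norm _ _

/-- A triangle is active only for `u` within relative error `τ` of being orthogonal to its vector.
If both were active, `x` and `y` would be nearly parallel, against the bound on their determinant.
-/
theorem middleSet_thinTriangle_eq_zero_or {x y u : Plane} {τ : ℝ} (hτ : 0 < τ) (hu : u ≠ 0)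
    (h : 2 * τ * (‖x‖ * ‖y‖) < |inner ℝ (quarterTurn x) y|) :
    middleSet (thinTriangle x τ) u = {0} ∨ middleSet (thinTriangle y τ) u = {0} := by
  by_contra! hcon
  have hle : ∀ z : Plane, middleSet (thinTriangle z τ) u ≠ {0} →
      |inner ℝ z u| ≤ τ * (‖z‖ * ‖u‖) := by
    intro z hz
    have h1 := not_lt.1 (mt middleSet_thinTriangle_eq_zero hz)
    have h2 := abs_sub (2 * inner ℝ z u + τ * inner ℝ (quarterTurn z) u)
      (τ * inner ℝ (quarterTurn z) u)
    rw [add_sub_cancel_right, abs_mul, abs_two] at h2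
    have h3 : |τ * inner ℝ (quarterTurn z) u| ≤ τ * (‖z‖ * ‖u‖) := by
      rw [abs_mul, abs_of_pos hτ]
      gcongr
      exact abs_inner_quarterTurn_le z u
    linarith
  have hx := hle x hcon.1
  have hy := hle y hcon.2
  have key : ‖u‖ ^ 2 * inner ℝ (quarterTurn x) y =
      inner ℝ x u * inner ℝ (quarterTurn u) y - inner ℝ y u * inner ℝ (quarterTurn u) x := by
    simp only [plane_norm_sq_eq, plane_inner_eq, quarterTurn_apply_zero, quarterTurn_apply_one]
    ring
  have hu' : 0 < ‖u‖ ^ 2 := pow_pos (norm_pos_iff.2 hu) 2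
  have hbound : ‖u‖ ^ 2 * |inner ℝ (quarterTurn x) y| ≤ ‖u‖ ^ 2 * (2 * τ * (‖x‖ * ‖y‖)) := by
    calc ‖u‖ ^ 2 * |inner ℝ (quarterTurn x) y|
        = |inner ℝ x u * inner ℝ (quarterTurn u) y - inner ℝ y u * inner ℝ (quarterTurn u) x| := by
          rw [← key, abs_mul, abs_of_pos hu']
      _ ≤ |inner ℝ x u| * |inner ℝ (quarterTurn u) y| +
          |inner ℝ y u| * |inner ℝ (quarterTurn u) x| := by
          rw [← abs_mul, ← abs_mul]
          exact abs_sub _ _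
      _ ≤ τ * (‖x‖ * ‖u‖) * (‖u‖ * ‖y‖) + τ * (‖y‖ * ‖u‖) * (‖u‖ * ‖x‖) := by
          gcongr <;> exact abs_inner_quarterTurn_le _ _
      _ = _ := by ring
  exact absurd (le_of_mul_le_mul_left hbound hu') (not_le.2 h)

theorem norm_le_of_mem_sum {ι : Type*} (s : Finset ι) (A : ι → ConvexBody Plane) {r : ℝ}
    (h : ∀ i ∈ s, ∀ x ∈ A i, ‖x‖ ≤ r) : ∀ x ∈ ∑ i ∈ s, A i, ‖x‖ ≤ s.card * r := by
  classical
  induction s using Finset.induction_on with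
  | empty =>
    intro x hx
    have : x = 0 := hx
    simp [this]
  | insert i s hi ih =>
    intro x hx
    rw [Finset.sum_insert hi] at hx
    obtain ⟨a, ha, b, hb, rfl⟩ := hx
    have h1 := h i (Finset.mem_insert_self i s) a ha
    have h2 := ih (fun j hj => h j (Finset.mem_insert_of_mem hj)) b hb
    have h3 := norm_add_le a b
    rw [Finset.card_insert_of_notMem hi]
    push_cast
    change ‖a + b‖ ≤ _
    linarith

/-- At most one summand is active for each normal, so the hedgehog of the sum lies in the union of
the hulls of `{0, z j, -z j - τ Jz j}`. Positivity in `hpos` makes the first and last of these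
points lose to `z i` in direction `v i`. The predicate `Q` records where the polygon added later has
constant middle set. -/
theorem exists_thinTriangle_sum {n : ℕ} {z v : Fin n → Plane} {r : ℝ} {Q : Plane → Prop}
    (hz : ∀ i, ‖z i‖ ≤ r) (hpos : ∀ i j, 0 < inner ℝ (z j) (v i))
    (hmax : ∀ i j, i ≠ j → inner ℝ (z j) (v i) < inner ℝ (z i) (v i))
    (hcross : ∀ i j, i ≠ j → inner ℝ (quarterTurn (z i)) (z j) ≠ 0)
    (hQ : ∀ i, ∀ᶠ u in 𝓝 (quarterTurn (z i)), Q u) :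
    ∃ A : ConvexBody Plane, (∀ x ∈ A, ‖x‖ ≤ n * (3 * r)) ∧
      (∀ i, ∀ q ∈ middleHedgehog A, q ≠ z i → inner ℝ q (v i) < inner ℝ (z i) (v i)) ∧
      ∀ i, ∃ u : Plane, u ≠ 0 ∧ Q u ∧ middleSet A u = {z i} := by
  have hz0 : ∀ i, z i ≠ 0 := fun i h => by simpa [h] using hpos i i
  have hlim : ∀ x y : Plane, Tendsto (fun τ : ℝ => x - τ • y) (𝓝[>] 0) (𝓝 x) := by
    intro x y
    have : Tendsto (fun τ : ℝ => x - τ • y) (𝓝 0) (𝓝 (x - (0 : ℝ) • y)) :=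
      Continuous.tendsto (by fun_prop) 0
    rw [zero_smul, sub_zero] at this
    exact this.mono_left nhdsWithin_le_nhds
  have e1 : ∀ᶠ τ in 𝓝[>] (0 : ℝ), ∀ i j, i ≠ j →
      2 * τ * (‖z i‖ * ‖z j‖) < |inner ℝ (quarterTurn (z i)) (z j)| := by
    refine eventually_all.2 fun i => eventually_all.2 fun j => ?_
    by_cases hij : i = j
    · simp [hij]
    have : Tendsto (fun τ : ℝ => 2 * τ * (‖z i‖ * ‖z j‖)) (𝓝 0)
        (𝓝 (2 * 0 * (‖z i‖ * ‖z j‖))) := Continuous.tendsto (by fun_prop) 0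
    rw [mul_zero, zero_mul] at this
    filter_upwards [nhdsWithin_le_nhds
      (this.eventually_lt_const (abs_pos.2 (hcross i j hij)))] with τ hτ _ using hτ
  have e2 : ∀ᶠ τ in 𝓝[>] (0 : ℝ), ∀ i j,
      inner ℝ (-z j - τ • quarterTurn (z j)) (v i) < 0 := by
    refine eventually_all.2 fun i => eventually_all.2 fun j => ?_
    have h : inner ℝ (-z j) (v i) < 0 := by
      rw [inner_neg_left]
      exact neg_neg_of_pos (hpos i j)
    exact (hlim (-z j) (quarterTurn (z j))).eventually
      ((isOpen_lt (f := fun x : Plane => inner ℝ x (v i)) (by fun_prop)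
        continuous_const).mem_nhds h)
  have e3 : ∀ᶠ τ in 𝓝[>] (0 : ℝ), ∀ i, Q (quarterTurn (z i) - (τ / 4) • z i) := by
    refine eventually_all.2 fun i => ?_
    have := (hlim (quarterTurn (z i)) ((1 / 4 : ℝ) • z i)).eventually (hQ i)
    filter_upwards [this] with τ hτ
    rwa [smul_smul, mul_one_div] at hτ
  have e4 : ∀ᶠ τ in 𝓝[>] (0 : ℝ), τ < 1 := nhdsWithin_le_nhds (gt_mem_nhds one_pos)
  obtain ⟨τ, h1, h2, h3, h4, hτ⟩ :=
    (e1.and (e2.and (e3.and (e4.and self_mem_nhdsWithin)))).exists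
  have hτ : 0 < τ := hτ
  have hsingle : ∀ u : Plane, ∀ i, (∀ j, j ≠ i → middleSet (thinTriangle (z j) τ) u = {0}) →
      middleSet (∑ j, thinTriangle (z j) τ) u = middleSet (thinTriangle (z i) τ) u := by
    intro u i hi
    rw [middleSet_sum]
    exact Finset.sum_eq_single i (fun j _ hj => hi j hj) (by simp)
  have hother : ∀ u : Plane, u ≠ 0 → ∀ i, middleSet (thinTriangle (z i) τ) u ≠ {0} →
      ∀ j, j ≠ i → middleSet (thinTriangle (z j) τ) u = {0} := by
    intro u hu i hi j hji
    exact (middleSet_thinTriangle_eq_zero_or hτ hu (h1 i j hji.symm)).resolve_left hi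
  refine ⟨∑ i, thinTriangle (z i) τ, ?_, ?_, ?_⟩
  · have := norm_le_of_mem_sum Finset.univ (fun i => thinTriangle (z i) τ) (r := 3 * r)
      fun i _ x hx => (norm_le_of_mem_thinTriangle hτ.le h4.le x hx).trans
        (by linarith [hz i])
    simpa using this
  · intro i q hq hne
    obtain ⟨u, hu, hq⟩ := mem_middleHedgehog.1 hq
    have hu0 : u ≠ 0 := norm_ne_zero_iff.1 (hu ▸ one_ne_zero)
    by_cases hall : ∀ j, middleSet (thinTriangle (z j) τ) u = {0}
    · rw [hsingle u i fun j _ => hall j, hall i] at hq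
      rw [mem_singleton_iff.1 hq, inner_zero_left]
      exact hpos i i
    · push Not at hall
      obtain ⟨j, hj⟩ := hall
      rw [hsingle u j (hother u hu0 j hj), thinTriangle, middleSet_finsetBody] at hq
      refine inner_lt_of_mem_convexHull (S := {0, z j, -z j - τ • quarterTurn (z j)}) ?_ q
        (convexHull_mono (vertexMidpoints_triangleVertices_subset (hz0 j) hτ hu0) hq) hne
      rintro x (rfl | rfl | rfl) hx
      · rw [inner_zero_left]
        exact hpos i i
      · exact hmax i j fun h => hx (h ▸ rfl)
      · exact (h2 i j).trans (hpos i i)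
  · intro i
    have hself := middleSet_thinTriangle_eq_self (hz0 i) hτ
    have hu0 : quarterTurn (z i) - (τ / 4) • z i ≠ 0 := by
      intro h
      have h5 : inner ℝ (quarterTurn (z i) - (τ / 4) • z i) (quarterTurn (z i)) = ‖z i‖ ^ 2 := by
        simp only [plane_inner_eq, plane_norm_sq_eq]
        simp
        ring
      rw [h, inner_zero_left] at h5
      exact hz0 i (by simpa using h5.symm)
    refine ⟨_, hu0, h3 i, ?_⟩
    rw [hsingle _ i (hother _ hu0 i ?_), hself]
    rw [hself]
    simpa using hz0 i

end Triangles

/-! ### Splitting an exposed point into many; conclusion of the category argument. -/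

section Density

open Set Metric Filter Topology

/-- Points on a small parabolic arc through `x` with axis direction `v`. -/
noncomputable def parabolaPoint (x v : Plane) (a : ℝ) : Plane := x + a • quarterTurn v - a ^ 2 • v

theorem inner_quarterTurn_parabolaPoint (x v : Plane) (a b : ℝ) :
    inner ℝ (quarterTurn (parabolaPoint x v a)) (parabolaPoint x v b) =
      (b - a) * (inner ℝ x v - (b + a) * inner ℝ (quarterTurn x) v + a * b * ‖v‖ ^ 2) := by
  simp only [parabolaPoint, plane_inner_eq, plane_norm_sq_eq]
  simp
  ring

/-- The direction `v + 2a Jv` is normal to the parabola at parameter `a`, so it exposes that point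
among all points of the curve when `v ≠ 0`. -/
theorem inner_parabolaPoint_sub (x v : Plane) (a b : ℝ) :
    inner ℝ (parabolaPoint x v a) (v + (2 * a) • quarterTurn v) -
      inner ℝ (parabolaPoint x v b) (v + (2 * a) • quarterTurn v) = ‖v‖ ^ 2 * (a - b) ^ 2 := by
  simp only [parabolaPoint, plane_inner_eq, plane_norm_sq_eq]
  simp
  ring

theorem dist_add_le_of_forall_norm_le (K A : ConvexBody Plane) {r : ℝ} (hr : 0 ≤ r)
    (h : ∀ x ∈ A, ‖x‖ ≤ r) : dist (K + A) K ≤ r := by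
  refine hausdorffDist_le_of_mem_dist hr ?_ fun x hx => ?_
  · rintro _ ⟨x, hx, a, ha, rfl⟩
    exact ⟨x, hx, by simpa using h a ha⟩
  · obtain ⟨a, ha⟩ := A.nonempty
    exact ⟨x + a, Set.add_mem_add hx ha, by simpa using h a ha⟩

theorem exists_dist_lt_exposed (K : ConvexBody Plane) {ε : ℝ} (hε : 0 < ε) (n : ℕ) :
    ∃ (L : ConvexBody Plane) (x v u : Fin n → Plane), dist L K < ε ∧ Function.Injective x ∧
      (∀ i, ∀ q ∈ middleHedgehog L, q ≠ x i → inner ℝ q (v i) < inner ℝ (x i) (v i)) ∧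
      ∀ i, u i ≠ 0 ∧ middleSet L (u i) = {x i} := by
  obtain ⟨s, hs, hdist, hgen⟩ := exists_generic_polygon_dist_lt K (half_pos hε)
  -- The `n` triangles together have radius at most `n * (3 * r) < ε / 2`; `n + 1` avoids division
  -- by zero.
  set r := ε / 2 / (3 * (n + 1)) with hr
  have hr0 : 0 < r := by positivity
  obtain ⟨p, v, w, hw, hneg, hexp, hmid⟩ := exists_exposed_vertexMidpoint hs hgen hr0
  -- Then `quarterTurn x = w`, so triangles attached to vectors near `x` are active for normals near
  -- `w`, where the polygon contributes exactly `p`.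
  set x := -quarterTurn w with hx
  have hxv : 0 < inner ℝ x v := by rw [hx, inner_neg_left]; exact neg_pos.2 hneg
  have hv0 : 0 < ‖v‖ := norm_pos_iff.2 fun h => by simp [h] at hxv
  have hxr : ‖x‖ < r := by rwa [hx, norm_neg, norm_quarterTurn]
  have hqx : quarterTurn x = w := by rw [hx, quarterTurn_neg, quarterTurn_quarterTurn, neg_neg]
  have hzlim : ∀ c : ℝ, Tendsto (fun t : ℝ => parabolaPoint x v (t * c)) (𝓝[>] 0) (𝓝 x) := by
    intro c
    have : Tendsto (fun t : ℝ => parabolaPoint x v (t * c)) (𝓝 0)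
        (𝓝 (parabolaPoint x v (0 * c))) := by
      unfold parabolaPoint
      exact Continuous.tendsto (by fun_prop) 0
    have h0 : parabolaPoint x v (0 * c) = x := by simp [parabolaPoint]
    rw [h0] at this
    exact this.mono_left nhdsWithin_le_nhds
  have hvlim : ∀ c : ℝ, Tendsto (fun t : ℝ => v + (2 * (t * c)) • quarterTurn v)
      (𝓝[>] 0) (𝓝 v) := by
    intro c
    have : Tendsto (fun t : ℝ => v + (2 * (t * c)) • quarterTurn v) (𝓝 0)
        (𝓝 (v + (2 * (0 * c)) • quarterTurn v)) := Continuous.tendsto (by fun_prop) 0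
    simp only [zero_mul, mul_zero, zero_smul, add_zero] at this
    exact this.mono_left nhdsWithin_le_nhds
  have e1 : ∀ᶠ t in 𝓝[>] (0 : ℝ), ∀ i : Fin n, ‖parabolaPoint x v (t * i)‖ < r :=
    eventually_all.2 fun i => (hzlim i).norm.eventually_lt_const hxr
  have e2 : ∀ᶠ t in 𝓝[>] (0 : ℝ), ∀ i j : Fin n, 0 < inner ℝ (parabolaPoint x v (t * j))
      (v + (2 * (t * (i : ℝ))) • quarterTurn v) :=
    eventually_all.2 fun i => eventually_all.2 fun j =>
      ((hzlim j).inner (hvlim i)).eventually_const_lt hxv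
  -- This is the second factor of the determinant of two parabola points; it tends to `inner ℝ x v >
  -- 0`, so distinct points are not parallel.
  have e3 : ∀ᶠ t in 𝓝[>] (0 : ℝ), ∀ i j : Fin n, 0 < inner ℝ x v -
      (t * j + t * i) * inner ℝ (quarterTurn x) v + t * i * (t * j) * ‖v‖ ^ 2 := by
    refine eventually_all.2 fun i => eventually_all.2 fun j => ?_
    have : Tendsto (fun t : ℝ => inner ℝ x v -
      (t * j + t * i) * inner ℝ (quarterTurn x) v + t * i * (t * j) * ‖v‖ ^ 2) (𝓝 0)
      (𝓝 (inner ℝ x v - ((0 : ℝ) * j + 0 * i) * inner ℝ (quarterTurn x) v +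
        0 * i * (0 * j) * ‖v‖ ^ 2)) := Continuous.tendsto (by fun_prop) 0
    simp only [zero_mul, add_zero, sub_zero] at this
    exact nhdsWithin_le_nhds (this.eventually_const_lt hxv)
  have e4 : ∀ᶠ t in 𝓝[>] (0 : ℝ), ∀ i : Fin n,
      ∀ z ∈ middleHedgehog (finsetBody s hs), z ≠ p →
        inner ℝ z (v + (2 * (t * (i : ℝ))) • quarterTurn v) <
          inner ℝ p (v + (2 * (t * (i : ℝ))) • quarterTurn v) :=
    eventually_all.2 fun i => (hvlim i).eventually hexp
  have e5 : ∀ᶠ t in 𝓝[>] (0 : ℝ), ∀ i : Fin n,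
      ∀ᶠ u in 𝓝 (quarterTurn (parabolaPoint x v (t * i))),
        middleSet (finsetBody s hs) u = {p} := by
    refine eventually_all.2 fun i => ?_
    have : Tendsto (fun t : ℝ => quarterTurn (parabolaPoint x v (t * i))) (𝓝[>] 0) (𝓝 w) := by
      rw [← hqx]
      exact (continuous_quarterTurn.tendsto x).comp (hzlim i)
    exact this.eventually hmid.eventually_nhds
  obtain ⟨t, h1, h2, h3, h4, h5, ht⟩ :=
    (e1.and (e2.and (e3.and (e4.and (e5.and self_mem_nhdsWithin))))).exists
  have ht : 0 < t := ht
  have hne : ∀ i j : Fin n, i ≠ j → t * (i : ℝ) - t * j ≠ 0 := by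
    intro i j hij h
    have h6 : t * (i : ℝ) = t * j := sub_eq_zero.1 h
    have h7 : (i : ℝ) = j := mul_left_cancel₀ ht.ne' h6
    exact hij (Fin.ext (by exact_mod_cast h7))
  have hmax : ∀ i j : Fin n, i ≠ j →
      inner ℝ (parabolaPoint x v (t * j)) (v + (2 * (t * (i : ℝ))) • quarterTurn v) <
        inner ℝ (parabolaPoint x v (t * i)) (v + (2 * (t * (i : ℝ))) • quarterTurn v) := by
    intro i j hij
    rw [← sub_pos, inner_parabolaPoint_sub]
    have := hne i j hij
    positivity
  obtain ⟨A, hA, hAexp, hAu⟩ := exists_thinTriangle_sum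
    (z := fun i : Fin n => parabolaPoint x v (t * i))
    (v := fun i : Fin n => v + (2 * (t * (i : ℝ))) • quarterTurn v) (r := r)
    (Q := fun u => middleSet (finsetBody s hs) u = {p}) (fun i => (h1 i).le) h2 hmax
    (fun i j hij => by
      rw [inner_quarterTurn_parabolaPoint]
      exact mul_ne_zero (hne j i hij.symm) (h3 i j).ne') h5
  choose u hu0 hQ hAu using hAu
  refine ⟨finsetBody s hs + A, fun i => p + parabolaPoint x v (t * i),
    fun i => v + (2 * (t * (i : ℝ))) • quarterTurn v, u, ?_, ?_, ?_, fun i => ⟨hu0 i, ?_⟩⟩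
  · have h6 := dist_add_le_of_forall_norm_le (finsetBody s hs) A (by positivity) hA
    have h7 := dist_triangle (finsetBody s hs + A) (finsetBody s hs) K
    have h8 : n * (3 * r) < ε / 2 := by
      have : (n + 1) * (3 * r) = ε / 2 := by rw [hr]; field_simp
      nlinarith
    linarith
  · intro i j hij
    by_contra hne'
    have := hmax i j hne'
    rw [add_left_cancel hij] at this
    exact lt_irrefl _ this
  -- A midpoint of the sum splits as `y + m` with both parts for the same normal; `y` is at most `p`
  -- and `m` at most the `i`-th parabola point in direction `v i`, with equality in both only at `x
  -- i`.
  · intro i q hq hqne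
    obtain ⟨u', hu', hq⟩ := mem_middleHedgehog.1 hq
    rw [middleSet_add] at hq
    obtain ⟨y, hy, m, hm, rfl⟩ := hq
    have hy' := h4 i y (mem_middleHedgehog.2 ⟨u', hu', hy⟩)
    have hm' := hAexp i m (mem_middleHedgehog.2 ⟨u', hu', hm⟩)
    simp only [inner_add_left]
    by_cases hyp : y = p
    · subst hyp
      have := hm' fun h => hqne (by simp only [h])
      linarith
    · have h6 := hy' hyp
      by_cases hmz : m = parabolaPoint x v (t * i)
      · rw [hmz]; linarith
      · have := hm' hmz
        linarith
  · rw [middleSet_add, hQ i, hAu i, singleton_add_singleton]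

/-- The body of `exists_dist_lt_exposed` is only a polygon plus triangles, but its exposed points
come from one-point middle sets, so they persist in nearby strictly convex bodies. -/
theorem exists_strictConvex_le_encard_hedgehogExposedPoints (K : ConvexBody Plane) {ε : ℝ}
    (hε : 0 < ε) (n : ℕ) : ∃ L : ConvexBody Plane, StrictConvex ℝ (L : Set Plane) ∧
      dist L K < ε ∧ (n : ℕ∞) ≤ (hedgehogExposedPoints L).encard := by
  obtain ⟨M, x, v, u, hd, hinj, hexp, hu⟩ := exists_dist_lt_exposed K hε n
  obtain ⟨η, hη, hall⟩ := exists_forall_le_encard_exposedPoints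
    (isCompact_middleHedgehog M) hinj hexp
  have hnear : ∀ᶠ L in 𝓝 M, ∀ i, ∃ z ∈ middleHedgehog L, dist z (x i) < η :=
    eventually_all.2 fun i => eventually_exists_mem_middleHedgehog (hu i).1 (hu i).2 hη
  have hclose : ∀ᶠ L in 𝓝 M, dist L K < ε := isOpen_ball.mem_nhds hd
  obtain ⟨L, hL, hLs⟩ := mem_closure_iff_nhds.1 (dense_setOf_strictConvex M) _
    ((eventually_middleHedgehog_subset_thickening M hη).and (hnear.and hclose))
  exact ⟨L, hLs, hL.2.2, hall _ (isCompact_middleHedgehog L) hL.1 hL.2.1⟩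

theorem isNowhereDense_setOf_encard_hedgehogExposedPoints_le (k : ℕ) :
    IsNowhereDense {K : StrictlyConvexBody | (hedgehogExposedPoints K.1).encard ≤ k} := by
  rw [(isClosed_setOf_encard_hedgehogExposedPoints_le k).isNowhereDense_iff,
    eq_empty_iff_forall_notMem]
  intro K hK
  obtain ⟨ε, hε, hball⟩ := Metric.isOpen_iff.1 isOpen_interior K hK
  obtain ⟨L, hL, hd, hcard⟩ :=
    exists_strictConvex_le_encard_hedgehogExposedPoints K.1 hε (k + 1)
  have hmem : (⟨L, hL⟩ : StrictlyConvexBody) ∈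
      {K : StrictlyConvexBody | (hedgehogExposedPoints K.1).encard ≤ k} :=
    interior_subset (hball (show (⟨L, hL⟩ : StrictlyConvexBody) ∈ ball K ε from hd))
  have : ((k + 1 : ℕ) : ℕ∞) ≤ k := hcard.trans hmem
  exact absurd (by exact_mod_cast this : k + 1 ≤ k) (by omega)

theorem setOf_infinite_hedgehogExposedPoints_mem_residual :
    {K : ConvexBody Plane | (hedgehogExposedPoints K).Infinite} ∈ residual (ConvexBody Plane) := by
  have h1 := residual_of_dense_Gδ isGδ_setOf_strictConvex dense_setOf_strictConvex
  have h2 : ∀ᶠ K in residual (ConvexBody Plane), ∀ k : ℕ,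
      K ∉ Subtype.val '' {K : StrictlyConvexBody | (hedgehogExposedPoints K.1).encard ≤ k} :=
    eventually_countable_forall.2 fun k =>
      (isNowhereDense_setOf_encard_hedgehogExposedPoints_le k).image_val.isMeagre
  filter_upwards [h1, h2] with K hK hK2
  by_contra hfin
  obtain ⟨k, hk⟩ := ENat.ne_top_iff_exists.1 (encard_ne_top_iff.2 (not_infinite.1 hfin))
  exact hK2 k ⟨⟨K, hK⟩, hk.ge, rfl⟩

end Density

theorem theorem3 :
    {K : ConvexBody Plane | (hedgehogExposedPoints K).Infinite} ∈ residual (ConvexBody Plane) ∧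
    (∀ k : ℕ,
      IsClosed {K : StrictlyConvexBody | (hedgehogExposedPoints K.1).encard ≤ k} ∧
      IsNowhereDense {K : StrictlyConvexBody | (hedgehogExposedPoints K.1).encard ≤ k}) ∧
    Dense {K : ConvexBody Plane | StrictConvex ℝ (K : Set Plane)} ∧
    IsGδ {K : ConvexBody Plane | StrictConvex ℝ (K : Set Plane)} :=
  ⟨setOf_infinite_hedgehogExposedPoints_mem_residual,
    fun k => ⟨isClosed_setOf_encard_hedgehogExposedPoints_le k,
      isNowhereDense_setOf_encard_hedgehogExposedPoints_le k⟩,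
    dense_setOf_strictConvex, isGδ_setOf_strictConvex⟩
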